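/- Let $d\ge 1$, let $|x|=\sum_i|x_i|$ and $\langle x,y\rangle=\sum_i x_iy_i$ on $\mathbb R^d$, and let $\|\cdot\|$ be the operator norm on $d\times d$ matrices associated with $|\cdot|$. Let $N$ be a random nonnegative integer and $A_1,A_2,\dots$ random $d\times d$ real matrices, defined on the same probability space. Assume the following. (A) $N\ge 1$ a.s., $1<\mathbb E[N]<\infty$, and a.s. all $A_i$ have nonnegative entries, $A_i\neq 0$ for $1\le i\le N$, and $A_i=0$ for $i>N$. (B) Let $\mu$ be the probability measure on matrices given by $\int f\,d\mu=\frac1{\mathbb E[N]}\mathbb E\big[\sum_{i=1}^N f(A_i)\big]$, let $M_1,M_2,\dots$ be i.i.d. with law $\mu$, put $I_\mu=\{s\ge 0:\int\|a\|^s\mu(da)<\infty\}$ and, for $s\in I_\mu$, $\kappa(s)=\lim_{n\to\infty}\big(\mathbb E\|M_n\cdots M_1\|^s\big)^{1/n}$ and $m(s)=\mathbb E[N]\,\kappa(s)$. There is $\alpha\in(0,1]\cap\mathrm{int}(I_\mu)$ with $m(\alpha)=1$ and $m'(\alpha)<0$. (C) With $N(t)=\#\{i\ge1: A_i^{T}t\ne0\}$: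 almost surely $N(t)\ge1$ for all $t\in\mathbb R^d\setminus\{0\}$; $\mathbb P[N(t)=1]<1$ for every $t\in\mathbb R^d\setminus\{0\}$; and there are $\varepsilon_0>0$ and, for each $t$ with $|t|=1$, a random index $i(t)\ge1$ with $A_{i(t)}^{T}t\neq0$ a.s., such that $\sup_{|t|=1}\mathbb E\big[|A_{i(t)}^{T}t|^{-\varepsilon_0}\big]<\infty$. Let $Z$ be an $\mathbb R_+^d$-valued random vector with $\mathbb P[Z=0]=0$ which satisfies $Z\overset{\mathcal L}{=}\sum_{i=1}^N A_iZ_i$, where $Z_1,Z_2,\dots$ are i.i.d. copies of $Z$, independent of $(N,A_1,A_2,\dots)$. 1. If $Z$ is not almost surely contained in a fixed affine hyperplane (that is, $\langle t,Z\rangle$ is not a.s. constant for any $t\neq0$), then there are constants $a>0$ and $C>0$ such that $$\big|\mathbb E\, e^{i\langle t,Z\rangle}\big|\le C|t|^{-a}\qquad\text{for all }t\in\mathbb R^d\setminus\{0\}.$$ 2. If there are linearly independent vectors $v_1,\dots,v_d\in\mathbb R_+^d\setminus\{0\}$ with $\mathbb R_+v_i\subset\mathrm{supp}(Z)$ for $i=1,\dots,d$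 (in which case $Z$ also satisfies the hypothesis of part 1), then the law of $Z$ is absolutely continuous with respect to Lebesgue measure on $\mathbb R^d$. -/

import Mathlib

open MeasureTheory ProbabilityTheory Filter Topology
open scoped ENNReal Matrix

noncomputable section

namespace Smoothing

/-- Matrices carry the product (= Borel) σ-algebra of their entries. -/
instance instMeasurableSpaceMatrix {d : ℕ} : MeasurableSpace (Matrix (Fin d) (Fin d) ℝ) :=
  inferInstanceAs (MeasurableSpace (Fin d → Fin d → ℝ))

instance instBorelSpaceMatrix {d : ℕ} : BorelSpace (Matrix (Fin d) (Fin d) ℝ) :=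
  inferInstanceAs (BorelSpace (Fin d → Fin d → ℝ))

/-- The `L¹` norm `|x| = ∑ |x_i|` of a vector. -/
def l1norm {d : ℕ} (x : Fin d → ℝ) : ℝ := ∑ i, |x i|

/-- The operator norm of a matrix acting on `ℝ^d` with the `L¹` norm. -/
def opNorm {d : ℕ} (a : Matrix (Fin d) (Fin d) ℝ) : ℝ :=
  ‖LinearMap.toContinuousLinearMap (Matrix.toLpLin 1 1 a)‖

variable {Ω : Type*} [MeasurableSpace Ω] {d : ℕ}

/-- `E[N]`. -/
def meanN (P : Measure Ω) (N : Ω → ℕ) : ℝ := ∫ ω, (N ω : ℝ) ∂P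

/-- `N ≥ 1` a.s., `E[N] ∈ (1, ∞)`, the matrices are nonnegative, the first `N` of them are nonzero
and the others vanish. The matrix `A i` is the one usually written `A_{i+1}`. -/
structure BranchingCondition (P : Measure Ω) (N : Ω → ℕ)
    (A : ℕ → Ω → Matrix (Fin d) (Fin d) ℝ) : Prop where
  one_le : ∀ᵐ ω ∂P, 1 ≤ N ω
  integrable : Integrable (fun ω => (N ω : ℝ)) P
  one_lt_mean : 1 < meanN P N
  nonneg : ∀ᵐ ω ∂P, ∀ i j k, 0 ≤ A i ω j k
  ne_zero : ∀ᵐ ω ∂P, ∀ i, i < N ω → A i ω ≠ 0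
  eq_zero : ∀ᵐ ω ∂P, ∀ i, N ω ≤ i → A i ω = 0

/-- The measure `μ` on matrices with `∫ f dμ = E[N]⁻¹ E[∑_{i=1}^N f(A_i)]`. -/
def intensity (P : Measure Ω) (N : Ω → ℕ) (A : ℕ → Ω → Matrix (Fin d) (Fin d) ℝ) :
    Measure (Matrix (Fin d) (Fin d) ℝ) :=
  (ENNReal.ofReal (meanN P N))⁻¹ •
    Measure.sum (fun i => (P.restrict {ω | i < N ω}).map (A i))

/-- `I_μ = {s ≥ 0 : ∫ ‖a‖^s μ(da) < ∞}`. -/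
def momentSet (μ : Measure (Matrix (Fin d) (Fin d) ℝ)) : Set ℝ :=
  {s | 0 ≤ s ∧ ∫⁻ a, ENNReal.ofReal (opNorm a) ^ s ∂μ < ∞}

/-- `E ‖M_n ⋯ M_1‖^s` for i.i.d. `M_1, …, M_n` with law `μ`. -/
def productMoment (μ : Measure (Matrix (Fin d) (Fin d) ℝ)) (s : ℝ) (n : ℕ) : ℝ≥0∞ :=
  ∫⁻ M : Fin n → Matrix (Fin d) (Fin d) ℝ,
    ENNReal.ofReal (opNorm (List.ofFn M).reverse.prod) ^ s ∂(Measure.pi fun _ => μ)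

/-- `κ(s) = lim_n (E ‖M_n ⋯ M_1‖^s)^{1/n}`; the limit exists for `s ∈ I_μ` by submultiplicativity. -/
def kappa (μ : Measure (Matrix (Fin d) (Fin d) ℝ)) (s : ℝ) : ℝ :=
  limUnder atTop (fun n : ℕ => (productMoment μ s n).toReal ^ (1 / (n : ℝ)))

/-- `m(s) = E[N] κ(s)`. -/
def mFun (P : Measure Ω) (N : Ω → ℕ) (A : ℕ → Ω → Matrix (Fin d) (Fin d) ℝ) (s : ℝ) : ℝ :=
  meanN P N * kappa (intensity P N A) s

/-- There is `α ∈ (0,1] ∩ int I_μ` with `m(α) = 1` and `m'(α) < 0`. (A nonzero value of `deriv`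
includes differentiability.) -/
def AlphaCondition (P : Measure Ω) (N : Ω → ℕ) (A : ℕ → Ω → Matrix (Fin d) (Fin d) ℝ) : Prop :=
  ∃ α ∈ Set.Ioc (0 : ℝ) 1 ∩ interior (momentSet (intensity P N A)),
    mFun P N A α = 1 ∧ deriv (mFun P N A) α < 0

/-- `N(t) = #{i : A_iᵀ t ≠ 0}`. -/
def activeCount (A : ℕ → Ω → Matrix (Fin d) (Fin d) ℝ) (t : Fin d → ℝ) (ω : Ω) : ℕ∞ :=
  {i : ℕ | (A i ω)ᵀ *ᵥ t ≠ 0}.encard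

/-- A.s. `N(t) ≥ 1` for all `t ≠ 0`; `P[N(t) = 1] < 1` for each `t ≠ 0`; and for some `ε₀ > 0` and
some random indices `i(t)` with `A_{i(t)}ᵀ t ≠ 0` a.s., the moments `E |A_{i(t)}ᵀ t|^{-ε₀}` are
bounded uniformly over the unit sphere. -/
structure ActivityCondition (P : Measure Ω) (A : ℕ → Ω → Matrix (Fin d) (Fin d) ℝ) :
    Prop where
  one_le : ∀ᵐ ω ∂P, ∀ t : Fin d → ℝ, t ≠ 0 → 1 ≤ activeCount A t ω
  prob_lt_one : ∀ t : Fin d → ℝ, t ≠ 0 → P {ω | activeCount A t ω = 1} < 1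
  harmonic : ∃ ε₀ : ℝ, 0 < ε₀ ∧ ∃ i : (Fin d → ℝ) → Ω → ℕ,
    (∀ t, l1norm t = 1 → Measurable (i t) ∧ ∀ᵐ ω ∂P, (A (i t ω) ω)ᵀ *ᵥ t ≠ 0) ∧
    (⨆ t ∈ {t : Fin d → ℝ | l1norm t = 1},
      ∫⁻ ω, ENNReal.ofReal (l1norm ((A (i t ω) ω)ᵀ *ᵥ t)) ^ (-ε₀) ∂P) < ∞

/-- The smoothing transform: the law of `∑_{i=1}^N A_i Z_i`, where the `Z_i` are i.i.d. with law
`η` and independent of `(N, A_1, A_2, …)`. -/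
def smoothingTransform (P : Measure Ω) (N : Ω → ℕ) (A : ℕ → Ω → Matrix (Fin d) (Fin d) ℝ)
    (η : Measure (Fin d → ℝ)) : Measure (Fin d → ℝ) :=
  (P.prod (Measure.infinitePi fun _ : ℕ => η)).map
    (fun p => ∑ i ∈ Finset.range (N p.1), A i p.1 *ᵥ p.2 i)

end Smoothing

end

/-! Write φ for the characteristic function of Z. Conditioning on the first generation gives φ(t) =
E ∏ φ(A_iᵀ t) (`chf_fixed`), so both claims rest on following the vectors A_iᵀ t.

Lyapunov function. Since m(α) = 1 and m'(α) < 0, some s > α has m(s) < 1. This yields w comparable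
with |t|^s such that the mean of ∑ w(A_iᵀ t) is at most ρ w(t) with ρ < 1 (`exists_lyapunov`).
Keeping only the child T = A_jᵀ t with the index from (C), one has |φ(t)| ≤ E|φ(T)|, contraction of
w in mean, and a negative moment of |T| of order |t|^{-ε} (`exists_childStep`).

Gap. If |φ(t)| = 1 for some t ≠ 0, equality persists along T, and contraction of w gives t_n → 0
with |φ(t_n)| = 1; then ⟨u, Z⟩ is a.s. constant for a limit direction u, which nondegeneracy
excludes. So |φ| < 1 off the origin. A minimum principle, with a barrier built from w^{-θ}, upgrades
this to sup_{|t| ≥ 1} |φ| ≤ l < 1 (`exists_gap`).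

Decay. For large |t|, with probability at least p > 0 two children have norm at least one, so a
factor other than that of T is at most l. This gain of (1 - l)p beats the cost of comparing |t|^a
with |T|^a, which is O(a); iterating bounds |φ(t)| |t|^a (`exists_decay`).

Absolute continuity. The rays exclude affine hyperplanes, so φ decays polynomially. More generally,
C_1 Z_1 + ⋯ + C_k Z_k is absolutely continuous whenever the ranges of the C_i span the target
(`absContBelow`); the identity map is the case needed. If all C_i are surjective and k is large, the
characteristic function is integrable. Smaller k follow by replacing one summand by its first
generation: with probability at least p this raises the number of nonzero summands, so the supremal
singular mass σ satisfies σ ≤ (1 - p)σ. A nonzero map that is not surjective is split off by Fubini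
along its range, with induction on the dimension. -/

noncomputable section

namespace Smoothing

/-! ### Norms -/

section Norms

variable {d : ℕ}

lemma l1norm_nonneg (x : Fin d → ℝ) : 0 ≤ l1norm x :=
  Finset.sum_nonneg fun _ _ => abs_nonneg _

lemma l1norm_eq_zero {x : Fin d → ℝ} : l1norm x = 0 ↔ x = 0 := by
  rw [l1norm, Finset.sum_eq_zero_iff_of_nonneg fun _ _ => abs_nonneg _]
  simp [funext_iff]

lemma l1norm_pos {x : Fin d → ℝ} (hx : x ≠ 0) : 0 < l1norm x :=
  (l1norm_nonneg x).lt_of_ne fun h => hx (l1norm_eq_zero.1 h.symm)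

lemma l1norm_smul (c : ℝ) (x : Fin d → ℝ) : l1norm (c • x) = |c| * l1norm x := by
  simp [l1norm, abs_mul, Finset.mul_sum]

lemma continuous_l1norm : Continuous (l1norm : (Fin d → ℝ) → ℝ) := by
  unfold l1norm; fun_prop

lemma abs_dotProduct_le (x y : Fin d → ℝ) : |x ⬝ᵥ y| ≤ l1norm x * l1norm y := by
  calc |x ⬝ᵥ y| ≤ ∑ i, |x i * y i| := Finset.abs_sum_le_sum_abs _ _
    _ ≤ ∑ i, |x i| * l1norm y := by
      refine Finset.sum_le_sum fun i _ => ?_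
      rw [abs_mul]
      gcongr
      exact Finset.single_le_sum (f := fun i => |y i|) (fun _ _ => abs_nonneg _) (Finset.mem_univ i)
    _ = l1norm x * l1norm y := by rw [← Finset.sum_mul]; rfl

lemma norm_toLp_one (x : Fin d → ℝ) : ‖WithLp.toLp 1 x‖ = l1norm x := by
  rw [PiLp.norm_eq_of_L1]; rfl

lemma opNorm_nonneg (a : Matrix (Fin d) (Fin d) ℝ) : 0 ≤ opNorm a := norm_nonneg _

lemma opNorm_mul_le (a b : Matrix (Fin d) (Fin d) ℝ) : opNorm (a * b) ≤ opNorm a * opNorm b := by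
  unfold opNorm
  have : (Matrix.toLpLin 1 1 (a * b) : WithLp 1 (Fin d → ℝ) →ₗ[ℝ] WithLp 1 (Fin d → ℝ))
      = (Matrix.toLpLin 1 1 a).comp (Matrix.toLpLin 1 1 b) := by
    ext x; simp [Matrix.toLpLin_apply]
  rw [this]
  exact ContinuousLinearMap.opNorm_comp_le (LinearMap.toContinuousLinearMap (Matrix.toLpLin 1 1 a))
    (LinearMap.toContinuousLinearMap (Matrix.toLpLin 1 1 b))

lemma continuous_opNorm : Continuous (opNorm : Matrix (Fin d) (Fin d) ℝ → ℝ) := by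
  unfold opNorm
  refine continuous_norm.comp ?_
  exact ((LinearMap.toContinuousLinearMap :
    (WithLp 1 (Fin d → ℝ) →ₗ[ℝ] WithLp 1 (Fin d → ℝ)) ≃ₗ[ℝ] _).toLinearMap.comp
      (Matrix.toLpLin 1 1 :
        Matrix (Fin d) (Fin d) ℝ ≃ₗ[ℝ] _).toLinearMap).continuous_of_finiteDimensional

lemma l1norm_mulVec_le (a : Matrix (Fin d) (Fin d) ℝ) (x : Fin d → ℝ) :
    l1norm (a *ᵥ x) ≤ opNorm a * l1norm x := by
  have := (LinearMap.toContinuousLinearMap (Matrix.toLpLin 1 1 a)).le_opNorm (WithLp.toLp 1 x)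
  simpa [Matrix.toLpLin_apply, norm_toLp_one, opNorm] using this

lemma l1norm_transpose_mulVec_le (a : Matrix (Fin d) (Fin d) ℝ) (t : Fin d → ℝ) :
    l1norm (aᵀ *ᵥ t) ≤ d * opNorm a * l1norm t := by
  have key : ∀ j, |(aᵀ *ᵥ t) j| ≤ opNorm a * l1norm t := by
    intro j
    have h1 : (aᵀ *ᵥ t) j = t ⬝ᵥ (a *ᵥ Pi.single j 1) := by
      rw [Matrix.mulVec_single_one, dotProduct_comm]; rfl
    rw [h1]
    refine (abs_dotProduct_le _ _).trans ?_
    have h2 := l1norm_mulVec_le a (Pi.single j 1)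
    have h3 : l1norm (Pi.single j (1 : ℝ)) = 1 := by
      rw [l1norm, Finset.sum_eq_single j] <;> simp +contextual
    rw [h3, mul_one] at h2
    rw [mul_comm]
    exact mul_le_mul_of_nonneg_right h2 (l1norm_nonneg _)
  calc l1norm (aᵀ *ᵥ t) ≤ ∑ _j : Fin d, opNorm a * l1norm t := Finset.sum_le_sum fun j _ => key j
    _ = _ := by simp [mul_assoc]

end Norms

/-! ### Moments of products -/

section ProductMoment

variable {d : ℕ} (μ : Measure (Matrix (Fin d) (Fin d) ℝ))

instance instMeasurableMulMatrix : MeasurableMul₂ (Matrix (Fin d) (Fin d) ℝ) where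
  measurable_mul := by
    refine measurable_pi_iff.2 fun i => measurable_pi_iff.2 fun j => ?_
    simp only [Matrix.mul_apply]
    refine Finset.measurable_sum _ fun k _ => Measurable.mul ?_ ?_
    · exact (measurable_pi_apply k).comp ((measurable_pi_apply i).comp measurable_fst)
    · exact (measurable_pi_apply j).comp ((measurable_pi_apply k).comp measurable_snd)

/-- The product `M_n ⋯ M_1`. -/
def revProd {n : ℕ} (M : Fin n → Matrix (Fin d) (Fin d) ℝ) : Matrix (Fin d) (Fin d) ℝ :=
  (List.ofFn M).reverse.prod

lemma revProd_succ {n : ℕ} (M : Fin (n + 1) → Matrix (Fin d) (Fin d) ℝ) :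
    revProd M = M (Fin.last n) * revProd (fun i => M i.castSucc) := by
  rw [revProd, List.ofFn_succ']
  simp [revProd]

lemma measurable_revProd (n : ℕ) :
    Measurable (revProd : (Fin n → Matrix (Fin d) (Fin d) ℝ) → _) := by
  induction n with
  | zero =>
    have : (revProd : (Fin 0 → Matrix (Fin d) (Fin d) ℝ) → _) = fun _ => 1 := by
      ext1 M; simp [revProd]
    rw [this]
    exact measurable_const
  | succ n ih =>
    simp only [funext revProd_succ]
    exact (measurable_pi_apply _).mul
      (ih.comp (measurable_pi_lambda _ fun i => measurable_pi_apply _))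

/-- `E ‖b M_n ⋯ M_1‖^s`. -/
def leftMoment (s : ℝ) (n : ℕ) (b : Matrix (Fin d) (Fin d) ℝ) : ℝ≥0∞ :=
  ∫⁻ M : Fin n → Matrix (Fin d) (Fin d) ℝ,
    ENNReal.ofReal (opNorm (b * revProd M)) ^ s ∂(Measure.pi fun _ => μ)

lemma leftMoment_one (s : ℝ) (n : ℕ) : leftMoment μ s n 1 = productMoment μ s n := by
  simp [leftMoment, productMoment, revProd]

lemma measurable_opNorm_rpow (s : ℝ) :
    Measurable fun a : Matrix (Fin d) (Fin d) ℝ => ENNReal.ofReal (opNorm a) ^ s :=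
  (ENNReal.measurable_ofReal.comp continuous_opNorm.measurable).pow_const s

lemma leftMoment_le {s : ℝ} (hs : 0 ≤ s) (n : ℕ) (b : Matrix (Fin d) (Fin d) ℝ) :
    leftMoment μ s n b ≤ productMoment μ s n * ENNReal.ofReal (opNorm b) ^ s := by
  have hm : Measurable fun M : Fin n → Matrix (Fin d) (Fin d) ℝ =>
      ENNReal.ofReal (opNorm (revProd M)) ^ s :=
    (measurable_opNorm_rpow s).comp (measurable_revProd n)
  rw [← leftMoment_one, leftMoment, leftMoment]
  simp only [one_mul]
  rw [← lintegral_mul_const _ hm]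
  refine lintegral_mono fun M => ?_
  rw [← ENNReal.mul_rpow_of_nonneg _ _ hs, ← ENNReal.ofReal_mul (opNorm_nonneg _), mul_comm (opNorm _)]
  exact ENNReal.rpow_le_rpow (ENNReal.ofReal_le_ofReal (opNorm_mul_le _ _)) hs

variable [IsProbabilityMeasure μ]

lemma lintegral_revProd_succ (n : ℕ) {Φ : Matrix (Fin d) (Fin d) ℝ → ℝ≥0∞} (hΦ : Measurable Φ) :
    ∫⁻ M : Fin (n + 1) → Matrix (Fin d) (Fin d) ℝ, Φ (revProd M) ∂(Measure.pi fun _ => μ) =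
      ∫⁻ a, ∫⁻ M : Fin n → Matrix (Fin d) (Fin d) ℝ, Φ (a * revProd M)
        ∂(Measure.pi fun _ => μ) ∂μ := by
  have hmp := measurePreserving_piFinSuccAbove (fun _ : Fin (n + 1) => μ) (Fin.last n)
  have hmeas : Measurable fun p : Matrix (Fin d) (Fin d) ℝ × (Fin n → Matrix (Fin d) (Fin d) ℝ) =>
      Φ (p.1 * revProd p.2) :=
    hΦ.comp (measurable_fst.mul ((measurable_revProd n).comp measurable_snd))
  rw [← lintegral_prod _ hmeas.aemeasurable, ← hmp.lintegral_comp hmeas]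
  refine lintegral_congr fun M => ?_
  rw [revProd_succ]
  congr 3
  ext i : 1
  simp [MeasurableEquiv.piFinSuccAbove, Fin.init]

lemma leftMoment_succ (s : ℝ) (n : ℕ) (b : Matrix (Fin d) (Fin d) ℝ) :
    leftMoment μ s (n + 1) b = ∫⁻ a, leftMoment μ s n (b * a) ∂μ := by
  simp only [leftMoment, mul_assoc]
  exact lintegral_revProd_succ μ n (Φ := fun a => ENNReal.ofReal (opNorm (b * a)) ^ s)
    ((measurable_opNorm_rpow s).comp (measurable_const_mul b))

/-- The free left factor `b` lets the induction on `n` peel off one matrix at a time; at `b = 1`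
this is submultiplicativity of the product moments. -/
lemma leftMoment_add_le {s : ℝ} (hs : 0 ≤ s) (m n : ℕ) (b : Matrix (Fin d) (Fin d) ℝ)
    (hfin : productMoment μ s m ≠ ∞) :
    leftMoment μ s (m + n) b ≤ productMoment μ s m * leftMoment μ s n b := by
  induction n generalizing b with
  | zero =>
    refine (leftMoment_le μ hs m b).trans_eq ?_
    simp [leftMoment, revProd]
  | succ n ih =>
    rw [← add_assoc, leftMoment_succ, leftMoment_succ, ← lintegral_const_mul' _ _ hfin]
    exact lintegral_mono fun a => ih _

lemma productMoment_ne_top {s : ℝ} (hs : s ∈ momentSet μ) (n : ℕ) : productMoment μ s n ≠ ∞ := by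
  obtain ⟨hs0, hs1⟩ := hs
  induction n with
  | zero => simp [productMoment, ENNReal.rpow_ne_top_of_nonneg hs0]
  | succ n ih =>
    rw [← leftMoment_one, leftMoment_succ]
    refine ((lintegral_mono fun a => leftMoment_le μ hs0 n (1 * a)).trans_lt ?_).ne
    simp only [one_mul]
    rw [lintegral_const_mul' _ _ ih]
    exact ENNReal.mul_lt_top ih.lt_top hs1

lemma productMoment_add_le {s : ℝ} (hs : s ∈ momentSet μ) (m n : ℕ) :
    productMoment μ s (m + n) ≤ productMoment μ s m * productMoment μ s n := by
  simpa only [leftMoment_one] using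
    leftMoment_add_le μ hs.1 m n 1 (productMoment_ne_top μ hs m)

/-- Fekete's lemma for a submultiplicative sequence of nonnegative numbers. -/
lemma exists_tendsto_rpow_of_submultiplicative {v : ℕ → ℝ} (h0 : ∀ n, 0 ≤ v n)
    (hv : ∀ m n, v (m + n) ≤ v m * v n) :
    ∃ L, Tendsto (fun n : ℕ => v n ^ (1 / (n : ℝ))) atTop (𝓝 L) := by
  by_cases hz : ∃ k, v k = 0
  -- One zero forces all later terms to vanish; otherwise logarithms are available.
  · obtain ⟨k, hk⟩ := hz
    refine ⟨0, tendsto_const_nhds.congr' ?_⟩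
    filter_upwards [eventually_ge_atTop (k + 1)] with n hn
    have : v n = 0 := by
      obtain ⟨j, rfl⟩ := Nat.exists_eq_add_of_le (show k ≤ n by omega)
      exact le_antisymm ((hv k j).trans_eq (by simp [hk])) (h0 _)
    rw [this, Real.zero_rpow]
    have : (0 : ℝ) < n := by exact_mod_cast (show 0 < n by omega)
    positivity
  · push Not at hz
    have hpos : ∀ n, 0 < v n := fun n => (h0 n).lt_of_ne (hz n).symm
    have hsub : Subadditive fun n => Real.log (v n) := fun m n => by
      rw [← Real.log_mul (hpos m).ne' (hpos n).ne']
      exact Real.log_le_log (hpos _) (hv m n)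
    have heq : ∀ n : ℕ, v n ^ (1 / (n : ℝ)) = Real.exp (Real.log (v n) / n) := fun n => by
      rw [Real.rpow_def_of_pos (hpos n)]; ring_nf
    set S : Set ℝ := (fun n : ℕ => Real.exp (Real.log (v n) / n)) '' Set.Ici 1
    have hbdd : BddBelow S := ⟨0, by rintro _ ⟨n, -, rfl⟩; positivity⟩
    refine ⟨sInf S, ?_⟩
    simp only [heq]
    refine tendsto_order.2 ⟨fun c hc => ?_, fun c hc => ?_⟩
    · filter_upwards [eventually_ge_atTop 1] with n hn
      exact hc.trans_le (csInf_le hbdd ⟨n, hn, rfl⟩)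
    · obtain ⟨_, ⟨n, hn, rfl⟩, hlt⟩ := exists_lt_of_csInf_lt
        (Set.Nonempty.image _ ⟨1, Set.mem_Ici.2 le_rfl⟩) hc
      have hcpos : 0 < c := (Real.exp_pos _).trans hlt
      have h1 : Real.log (v n) / n < Real.log c := (Real.lt_log_iff_exp_lt hcpos).2 hlt
      have hn1 : 1 ≤ n := hn
      filter_upwards [hsub.eventually_div_lt_of_div_lt (by omega) h1] with p hp
      exact (Real.lt_log_iff_exp_lt hcpos).1 hp

lemma tendsto_kappa {s : ℝ} (hs : s ∈ momentSet μ) :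
    Tendsto (fun n : ℕ => (productMoment μ s n).toReal ^ (1 / (n : ℝ))) atTop (𝓝 (kappa μ s)) := by
  refine tendsto_nhds_limUnder ?_
  refine exists_tendsto_rpow_of_submultiplicative (fun _ => ENNReal.toReal_nonneg) fun m n => ?_
  rw [← ENNReal.toReal_mul]
  exact ENNReal.toReal_mono
    (ENNReal.mul_ne_top (productMoment_ne_top μ hs m) (productMoment_ne_top μ hs n))
    (productMoment_add_le μ hs m n)

end ProductMoment

/-! ### The intensity measure and a Lyapunov function -/

section Lyapunov

variable {Ω : Type*} [MeasurableSpace Ω] {d : ℕ} {P : Measure Ω} {N : Ω → ℕ}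
  {A : ℕ → Ω → Matrix (Fin d) (Fin d) ℝ}

lemma lintegral_sum_range (hN : Measurable N) {f : ℕ → Ω → ℝ≥0∞} (hf : ∀ i, Measurable (f i)) :
    ∫⁻ ω, ∑ i ∈ Finset.range (N ω), f i ω ∂P = ∑' i, ∫⁻ ω in {ω | i < N ω}, f i ω ∂P := by
  have hset : ∀ i, MeasurableSet {ω | i < N ω} := fun i => measurableSet_lt measurable_const hN
  have h1 : ∀ ω, ∑ i ∈ Finset.range (N ω), f i ω = ∑' i, {ω | i < N ω}.indicator (f i) ω := by
    intro ω
    rw [tsum_eq_sum (s := Finset.range (N ω))]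
    · refine Finset.sum_congr rfl fun i hi => ?_
      rw [Set.indicator_of_mem]
      simpa using hi
    · intro i hi
      rw [Set.indicator_of_notMem]
      simpa using hi
  simp only [h1]
  rw [lintegral_tsum fun i => ((hf i).indicator (hset i)).aemeasurable]
  exact tsum_congr fun i => lintegral_indicator (hset i) _

/-- Many-to-one formula: it turns sums over children into integrals over one matrix of law μ, at the
price of a factor E[N]. -/
lemma lintegral_sum_eq_mul_lintegral_intensity (hN : Measurable N) (hA : ∀ i, Measurable (A i))
    (hm : 1 < meanN P N) {f : Matrix (Fin d) (Fin d) ℝ → ℝ≥0∞} (hf : Measurable f) :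
    ∫⁻ ω, ∑ i ∈ Finset.range (N ω), f (A i ω) ∂P =
      ENNReal.ofReal (meanN P N) * ∫⁻ a, f a ∂(intensity P N A) := by
  rw [lintegral_sum_range hN (f := fun i ω => f (A i ω)) fun i => hf.comp (hA i), intensity, lintegral_smul_measure,
    lintegral_sum_measure, smul_eq_mul, ← mul_assoc, ENNReal.mul_inv_cancel (by simp; linarith)
      ENNReal.ofReal_ne_top, one_mul]
  exact tsum_congr fun i => (lintegral_map hf (hA i)).symm

lemma isProbabilityMeasure_intensity (hN : Measurable N) (hA : ∀ i, Measurable (A i))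
    (h : BranchingCondition P N A) : IsProbabilityMeasure (intensity P N A) := by
  have hm := h.one_lt_mean
  have h1 := lintegral_sum_eq_mul_lintegral_intensity hN hA hm (f := fun _ => 1) measurable_const
  have h2 : ENNReal.ofReal (meanN P N) = ∫⁻ ω, (N ω : ℝ≥0∞) ∂P := by
    rw [meanN, ofReal_integral_eq_lintegral_ofReal h.integrable (ae_of_all _ fun ω => by positivity)]
    simp
  simp only [Finset.sum_const, Finset.card_range, nsmul_eq_mul, mul_one, lintegral_const,
    one_mul] at h1
  rw [← h2] at h1
  refine ⟨?_⟩
  have h3 : ENNReal.ofReal (meanN P N) ≠ 0 := by simp; linarith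
  exact ((ENNReal.mul_right_inj h3 ENNReal.ofReal_ne_top).1 (by rw [mul_one]; exact h1)).symm

/-- `E |(M_n ⋯ M_1)ᵀ t|^s`. -/
def vectorMoment (μ : Measure (Matrix (Fin d) (Fin d) ℝ)) (s : ℝ) (n : ℕ) (t : Fin d → ℝ) : ℝ≥0∞ :=
  ∫⁻ M : Fin n → Matrix (Fin d) (Fin d) ℝ,
    ENNReal.ofReal (l1norm ((revProd M)ᵀ *ᵥ t)) ^ s ∂(Measure.pi fun _ => μ)

lemma measurable_transpose_mulVec :
    Measurable fun p : Matrix (Fin d) (Fin d) ℝ × (Fin d → ℝ) => p.1ᵀ *ᵥ p.2 := by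
  refine measurable_pi_iff.2 fun i => ?_
  simp only [Matrix.mulVec, dotProduct, Matrix.transpose_apply]
  refine Finset.measurable_sum _ fun k _ => Measurable.mul ?_ ?_
  · exact (measurable_pi_apply i).comp ((measurable_pi_apply k).comp measurable_fst)
  · exact (measurable_pi_apply k).comp measurable_snd

lemma measurable_transpose_mulVec_const (t : Fin d → ℝ) :
    Measurable fun a : Matrix (Fin d) (Fin d) ℝ => aᵀ *ᵥ t :=
  measurable_transpose_mulVec.comp (measurable_id.prodMk measurable_const)

lemma measurable_ofReal_l1norm_rpow (s : ℝ) :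
    Measurable fun t : Fin d → ℝ => ENNReal.ofReal (l1norm t) ^ s :=
  (ENNReal.measurable_ofReal.comp continuous_l1norm.measurable).pow_const s

variable (μ : Measure (Matrix (Fin d) (Fin d) ℝ))

lemma vectorMoment_zero [IsProbabilityMeasure μ] (s : ℝ) (t : Fin d → ℝ) :
    vectorMoment μ s 0 t = ENNReal.ofReal (l1norm t) ^ s := by
  simp [vectorMoment, revProd]

lemma vectorMoment_succ [IsProbabilityMeasure μ] (s : ℝ) (n : ℕ) (t : Fin d → ℝ) :
    vectorMoment μ s (n + 1) t = ∫⁻ a, vectorMoment μ s n (aᵀ *ᵥ t) ∂μ := by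
  have := lintegral_revProd_succ μ n (Φ := fun a => ENNReal.ofReal (l1norm (aᵀ *ᵥ t)) ^ s)
    ((measurable_ofReal_l1norm_rpow s).comp (measurable_transpose_mulVec_const t))
  simpa only [vectorMoment, Matrix.mulVec_mulVec, Matrix.transpose_mul] using this

lemma vectorMoment_le {s : ℝ} (hs : 0 ≤ s) (n : ℕ) (t : Fin d → ℝ) :
    vectorMoment μ s n t ≤
      (d : ℝ≥0∞) ^ s * productMoment μ s n * ENNReal.ofReal (l1norm t) ^ s := by
  have hm : Measurable fun M : Fin n → Matrix (Fin d) (Fin d) ℝ =>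
      ENNReal.ofReal (opNorm (revProd M)) ^ s :=
    (measurable_opNorm_rpow s).comp (measurable_revProd n)
  rw [← leftMoment_one, leftMoment]
  simp only [one_mul]
  rw [← lintegral_const_mul _ hm, ← lintegral_mul_const _ (hm.const_mul _)]
  refine lintegral_mono fun M => ?_
  rw [← ENNReal.mul_rpow_of_nonneg _ _ hs, ← ENNReal.mul_rpow_of_nonneg _ _ hs]
  refine ENNReal.rpow_le_rpow ?_ hs
  rw [← ENNReal.ofReal_natCast, ← ENNReal.ofReal_mul (by positivity),
    ← ENNReal.ofReal_mul (mul_nonneg (by positivity) (opNorm_nonneg _))]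
  exact ENNReal.ofReal_le_ofReal (l1norm_transpose_mulVec_le _ _)

lemma measurable_vectorMoment [IsProbabilityMeasure μ] (s : ℝ) (n : ℕ) :
    Measurable (vectorMoment μ s n) := by
  refine Measurable.lintegral_prod_right' (f := fun p : (Fin d → ℝ) ×
    (Fin n → Matrix (Fin d) (Fin d) ℝ) => ENNReal.ofReal (l1norm ((revProd p.2)ᵀ *ᵥ p.1)) ^ s) ?_
  exact (measurable_ofReal_l1norm_rpow s).comp (measurable_transpose_mulVec.comp
    (((measurable_revProd n).comp measurable_snd).prodMk measurable_fst))

/-- The negative derivative pushes m below 1 just to the right of α, and interiority of α keeps such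
exponents in the moment set. -/
lemma exists_mFun_lt_one (h : AlphaCondition P N A) :
    ∃ s, 0 < s ∧ s ∈ momentSet (intensity P N A) ∧ mFun P N A s < 1 := by
  obtain ⟨α, ⟨hα, hinteg⟩, h1, hd⟩ := h
  have hdiff : DifferentiableAt ℝ (mFun P N A) α := differentiableAt_of_deriv_ne_zero hd.ne
  have hs := (hasDerivAt_iff_tendsto_slope.1 hdiff.hasDerivAt).eventually (eventually_lt_nhds hd)
  have hs' : ∀ᶠ s in 𝓝[>] α, slope (mFun P N A) α s < 0 :=
    hs.filter_mono (nhdsWithin_mono _ fun s (hs : α < s) => hs.ne')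
  have hmem : ∀ᶠ s in 𝓝[>] α, s ∈ momentSet (intensity P N A) :=
    nhdsWithin_le_nhds (mem_interior_iff_mem_nhds.1 hinteg)
  obtain ⟨s, hs1, hs2, hs3⟩ := (hs'.and (hmem.and self_mem_nhdsWithin)).exists
  have hs3 : α < s := hs3
  refine ⟨s, hα.1.trans hs3, hs2, ?_⟩
  rw [slope_def_field, div_neg_iff] at hs1
  rcases hs1 with h | h <;> linarith

/-- The n-th roots of the moments fall below some r < 1/m, and |D| (m r)^n tends to zero. The free
constant `D` will absorb the factor d^s lost on passing to transposes. -/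
lemma exists_productMoment_small [IsProbabilityMeasure μ] {s m : ℝ} (hs : s ∈ momentSet μ)
    (hm : 0 < m) (hlt : m * kappa μ s < 1) (D : ℝ) :
    ∃ n : ℕ, 0 < n ∧ m ^ n * (D * (productMoment μ s n).toReal) < 1 := by
  have h0 : 0 ≤ kappa μ s :=
    ge_of_tendsto' (tendsto_kappa μ hs) fun n => Real.rpow_nonneg ENNReal.toReal_nonneg _
  have h1 : kappa μ s < 1 / m := by rwa [lt_div_iff₀ hm, mul_comm]
  obtain ⟨r, hr1, hr2⟩ := exists_between h1
  have hmr : m * r < 1 := by rwa [lt_div_iff₀ hm, mul_comm] at hr2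
  have hr0 : 0 ≤ r := h0.trans hr1.le
  have ht : Tendsto (fun n : ℕ => |D| * (m * r) ^ n) atTop (𝓝 (|D| * 0)) :=
    (tendsto_pow_atTop_nhds_zero_of_lt_one (by positivity) hmr).const_mul _
  rw [mul_zero] at ht
  obtain ⟨n, hn1, hn2, hn3⟩ := ((ht.eventually (eventually_lt_nhds one_pos)).and
    (((tendsto_kappa μ hs).eventually (eventually_lt_nhds hr1)).and
      (eventually_gt_atTop 0))).exists
  refine ⟨n, hn3, lt_of_le_of_lt ?_ hn1⟩
  have hn : (n : ℝ) ≠ 0 := by positivity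
  have hv : (productMoment μ s n).toReal ≤ r ^ n := by
    have := pow_le_pow_left₀ (Real.rpow_nonneg ENNReal.toReal_nonneg _) hn2.le n
    rwa [← Real.rpow_natCast, ← Real.rpow_mul ENNReal.toReal_nonneg, one_div,
      inv_mul_cancel₀ hn, Real.rpow_one] at this
  calc m ^ n * (D * (productMoment μ s n).toReal)
      ≤ m ^ n * (|D| * r ^ n) := by
        have := ENNReal.toReal_nonneg (a := productMoment μ s n)
        gcongr
        exact le_abs_self D
    _ = |D| * (m * r) ^ n := by rw [mul_pow]; ring

/-- Take w(t) = ∑_{k<n} (m/ρ)^k E|(M_k ⋯ M_1)ᵀ t|^s. By the many-to-one formula, averaging over the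
children replaces k by k + 1 and produces a factor ρ. The new top term k = n is at most the lost
term k = 0 by the choice of n and ρ. -/
lemma exists_lyapunov (hN : Measurable N) (hA : ∀ i, Measurable (A i))
    (hb : BranchingCondition P N A) (hα : AlphaCondition P N A) :
    ∃ (s ρ K : ℝ) (w : (Fin d → ℝ) → ℝ), 0 < s ∧ 0 < ρ ∧ ρ < 1 ∧ Measurable w ∧
      (∀ t, l1norm t ^ s ≤ w t) ∧ (∀ t, w t ≤ K * l1norm t ^ s) ∧
      ∀ t, ∫⁻ ω, ∑ i ∈ Finset.range (N ω), ENNReal.ofReal (w ((A i ω)ᵀ *ᵥ t)) ∂P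
        ≤ ENNReal.ofReal (ρ * w t) := by
  have := isProbabilityMeasure_intensity hN hA hb
  obtain ⟨s, hs0, hs, hlt⟩ := exists_mFun_lt_one hα
  set μ := intensity P N A
  set m := meanN P N
  have hm1 : 1 < m := hb.one_lt_mean
  have hm0 : 0 < m := by linarith
  obtain ⟨n, hn0, hn⟩ := exists_productMoment_small μ hs hm0 hlt ((d : ℝ) ^ s)
  have hx0 : 0 ≤ m ^ n * ((d : ℝ) ^ s * (productMoment μ s n).toReal) := by positivity
  obtain ⟨ρ, hρ0, hρ1, hρn⟩ : ∃ ρ : ℝ, 0 < ρ ∧ ρ < 1 ∧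
      m ^ n * ((d : ℝ) ^ s * (productMoment μ s n).toReal) ≤ ρ ^ n := by
    have hc : Tendsto (fun ρ : ℝ => ρ ^ n) (𝓝[<] 1) (𝓝 (1 ^ n)) :=
      ((continuous_pow n).tendsto 1).mono_left nhdsWithin_le_nhds
    rw [one_pow] at hc
    have hpos : ∀ᶠ ρ : ℝ in 𝓝[<] 1, 0 < ρ := nhdsWithin_le_nhds (eventually_gt_nhds one_pos)
    obtain ⟨ρ, h1, h2, h3⟩ := ((hc.eventually (eventually_gt_nhds hn)).and
      (hpos.and self_mem_nhdsWithin)).exists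
    exact ⟨ρ, h2, h3, h1.le⟩
  set g : ℕ → (Fin d → ℝ) → ℝ≥0∞ := vectorMoment μ s
  set c : ℕ → ℝ≥0∞ := fun k => ENNReal.ofReal ((m / ρ) ^ k)
  set W : (Fin d → ℝ) → ℝ≥0∞ := fun t => ∑ k ∈ Finset.range n, c k * g k t
  set κ : ℝ≥0∞ := ∑ k ∈ Finset.range n, c k * ((d : ℝ≥0∞) ^ s * productMoment μ s k)
  have hds : (d : ℝ≥0∞) ^ s ≠ ∞ := ENNReal.rpow_ne_top_of_nonneg hs0.le (by simp)
  have hκ : κ ≠ ∞ := ENNReal.sum_ne_top.2 fun k _ =>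
    ENNReal.mul_ne_top ENNReal.ofReal_ne_top
      (ENNReal.mul_ne_top hds (productMoment_ne_top μ hs k))
  have hWle : ∀ t, W t ≤ κ * ENNReal.ofReal (l1norm t) ^ s := by
    intro t
    simp only [W, κ, Finset.sum_mul]
    refine Finset.sum_le_sum fun k _ => ?_
    rw [mul_assoc]
    exact mul_le_mul_right (vectorMoment_le μ hs0.le k t) _
  have hgW : ∀ t, ENNReal.ofReal (l1norm t) ^ s ≤ W t := by
    intro t
    have : c 0 * g 0 t ≤ W t := Finset.single_le_sum (f := fun k => c k * g k t)
      (fun _ _ => zero_le) (Finset.mem_range.2 hn0)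
    simpa [c, g, vectorMoment_zero] using this
  have hpow : ∀ t : Fin d → ℝ, ENNReal.ofReal (l1norm t) ^ s = ENNReal.ofReal (l1norm t ^ s) :=
    fun t => ENNReal.ofReal_rpow_of_nonneg (l1norm_nonneg t) hs0.le
  have hWfin : ∀ t, W t ≠ ∞ := fun t =>
    ((hWle t).trans_lt (ENNReal.mul_lt_top hκ.lt_top (by rw [hpow]; simp))).ne
  have hWmeas : Measurable W :=
    Finset.measurable_sum _ fun k _ => (measurable_vectorMoment μ s k).const_mul _
  refine ⟨s, ρ, κ.toReal, fun t => (W t).toReal, hs0, hρ0, hρ1, hWmeas.ennreal_toReal,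
    fun t => ?_, fun t => ?_, fun t => ?_⟩
  · have := ENNReal.toReal_mono (hWfin t) (hgW t)
    rwa [hpow, ENNReal.toReal_ofReal (Real.rpow_nonneg (l1norm_nonneg t) _)] at this
  · have h1 : κ * ENNReal.ofReal (l1norm t) ^ s ≠ ∞ :=
      ENNReal.mul_ne_top hκ (by rw [hpow]; simp)
    have := ENNReal.toReal_mono h1 (hWle t)
    rwa [hpow, ENNReal.toReal_mul,
      ENNReal.toReal_ofReal (Real.rpow_nonneg (l1norm_nonneg t) _)] at this
  · simp only [ENNReal.ofReal_toReal (hWfin _)]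
    rw [lintegral_sum_eq_mul_lintegral_intensity hN hA hm1
      (f := fun a => W (aᵀ *ᵥ t)) (hWmeas.comp (measurable_transpose_mulVec_const t)),
      ENNReal.ofReal_mul hρ0.le, ENNReal.ofReal_toReal (hWfin t)]
    have h1 : ∫⁻ a, W (aᵀ *ᵥ t) ∂μ = ∑ k ∈ Finset.range n, c k * g (k + 1) t := by
      have hgm : ∀ k, Measurable fun a : Matrix (Fin d) (Fin d) ℝ => g k (aᵀ *ᵥ t) := fun k =>
        (measurable_vectorMoment μ s k).comp (measurable_transpose_mulVec_const t)
      simp only [W]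
      rw [lintegral_finsetSum _ fun k _ => (hgm k).const_mul _]
      refine Finset.sum_congr rfl fun k _ => ?_
      rw [lintegral_const_mul _ (hgm k)]
      exact congrArg _ (vectorMoment_succ μ s k t).symm
    have hc : ∀ k, ENNReal.ofReal m * c k = ENNReal.ofReal ρ * c (k + 1) := by
      intro k
      simp only [c]
      rw [← ENNReal.ofReal_mul hm0.le, ← ENNReal.ofReal_mul hρ0.le]
      congr 1
      rw [pow_succ]
      field_simp
    -- This closes the cycle: the choice `hρn` of ρ says exactly that the weight (m/ρ)^n d^s E‖M_n ⋯
    -- M_1‖^s is at most one.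
    have hgn : c n * g n t ≤ g 0 t := by
      calc c n * g n t
          ≤ c n * ((d : ℝ≥0∞) ^ s * productMoment μ s n * ENNReal.ofReal (l1norm t) ^ s) :=
            mul_le_mul_right (vectorMoment_le μ hs0.le n t) _
        _ = ENNReal.ofReal ((m / ρ) ^ n * ((d : ℝ) ^ s * (productMoment μ s n).toReal))
              * ENNReal.ofReal (l1norm t) ^ s := by
            rw [ENNReal.ofReal_mul (by positivity), ENNReal.ofReal_mul (by positivity),
              ENNReal.ofReal_toReal (productMoment_ne_top μ hs n),
              ← ENNReal.ofReal_rpow_of_nonneg (by positivity) hs0.le, ENNReal.ofReal_natCast]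
            ring
        _ ≤ 1 * ENNReal.ofReal (l1norm t) ^ s := by
            gcongr
            rw [ENNReal.ofReal_le_one, div_pow, div_mul_eq_mul_div, div_le_one (by positivity)]
            exact hρn
        _ = g 0 t := by simp [g, vectorMoment_zero]
    rw [h1, Finset.mul_sum, Finset.sum_congr rfl fun k _ =>
      show ENNReal.ofReal m * (c k * g (k + 1) t) = ENNReal.ofReal ρ * (c (k + 1) * g (k + 1) t) by
        rw [← mul_assoc, hc, mul_assoc], ← Finset.mul_sum]
    gcongr
    rcases Nat.exists_eq_succ_of_ne_zero hn0.ne' with ⟨j, rfl⟩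
    change _ ≤ ∑ k ∈ Finset.range (j + 1), c k * g k t
    rw [Finset.sum_range_succ, Finset.sum_range_succ' (fun k => c k * g k t)]
    refine add_le_add_right (hgn.trans_eq ?_) _
    simp [c]

end Lyapunov

/-! ### Laws of sums of independent linear images -/

section SumLaw

open Measure

variable {d : ℕ} {E : Type*} [NormedAddCommGroup E] [NormedSpace ℝ E] [FiniteDimensional ℝ E]
  [MeasurableSpace E] [BorelSpace E]
  {F : Type*} [NormedAddCommGroup F] [NormedSpace ℝ F] [FiniteDimensional ℝ F]
  [MeasurableSpace F] [BorelSpace F]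

/-- The law of `C_1 Z_1 + ⋯ + C_k Z_k` for i.i.d. `Z_i` with law `η`. -/
def sumLaw (η : Measure (Fin d → ℝ)) : List ((Fin d → ℝ) →L[ℝ] E) → Measure E
  | [] => dirac 0
  | C :: l => (η.map C) ∗ sumLaw η l

variable (η : Measure (Fin d → ℝ)) [IsProbabilityMeasure η]

instance instIsProbabilityMeasureSumLaw (l : List ((Fin d → ℝ) →L[ℝ] E)) :
    IsProbabilityMeasure (sumLaw η l) := by
  induction l with
  | nil => exact dirac.isProbabilityMeasure
  | cons C l ih =>
    have : IsProbabilityMeasure (η.map C) := isProbabilityMeasure_map (by fun_prop)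
    rw [sumLaw]
    infer_instance

lemma sumLaw_append (l l' : List ((Fin d → ℝ) →L[ℝ] E)) :
    sumLaw η (l ++ l') = sumLaw η l ∗ sumLaw η l' := by
  induction l with
  | nil => simp [sumLaw]
  | cons C l ih => rw [List.cons_append, sumLaw, sumLaw, ih, conv_assoc]

lemma sumLaw_perm {l l' : List ((Fin d → ℝ) →L[ℝ] E)} (h : l.Perm l') :
    sumLaw η l = sumLaw η l' := by
  induction h with
  | nil => rfl
  | cons C _ ih => rw [sumLaw, sumLaw, ih]
  | swap C C' l =>
    have : IsProbabilityMeasure (η.map C) := isProbabilityMeasure_map (by fun_prop)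
    have : IsProbabilityMeasure (η.map C') := isProbabilityMeasure_map (by fun_prop)
    rw [sumLaw, sumLaw, sumLaw, sumLaw, ← conv_assoc, ← conv_assoc, conv_comm (η.map C')]
  | trans _ _ h1 h2 => exact h1.trans h2

lemma sumLaw_zero_cons (l : List ((Fin d → ℝ) →L[ℝ] E)) : sumLaw η (0 :: l) = sumLaw η l := by
  rw [sumLaw]
  have : η.map (0 : (Fin d → ℝ) →L[ℝ] E) = dirac 0 := by
    rw [show ((0 : (Fin d → ℝ) →L[ℝ] E) : (Fin d → ℝ) → E) = fun _ => 0 from rfl, Measure.map_const]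
    simp
  rw [this, dirac_zero_conv]

open scoped Classical in
lemma sumLaw_filter_ne_zero (l : List ((Fin d → ℝ) →L[ℝ] E)) :
    sumLaw η (l.filter (· ≠ 0)) = sumLaw η l := by
  induction l with
  | nil => rfl
  | cons C l ih =>
    by_cases hC : C = 0
    · subst hC
      rw [sumLaw_zero_cons, ← ih, List.filter_cons_of_neg (by simp)]
    · rw [List.filter_cons_of_pos (by simpa using hC), sumLaw, sumLaw, ih]

lemma map_sumLaw (D : E →L[ℝ] F) (l : List ((Fin d → ℝ) →L[ℝ] E)) :
    (sumLaw η l).map D = sumLaw η (l.map D.comp) := by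
  induction l with
  | nil => simp [sumLaw, map_dirac' D.continuous.measurable]
  | cons C l ih =>
    have : IsProbabilityMeasure (η.map C) := isProbabilityMeasure_map (by fun_prop)
    rw [sumLaw, map_conv_continuousLinearMap, ih, List.map_cons, sumLaw,
      Measure.map_map (by fun_prop) (by fun_prop)]
    rfl

lemma charFunDual_sumLaw (l : List ((Fin d → ℝ) →L[ℝ] E)) (L : StrongDual ℝ E) :
    charFunDual (sumLaw η l) L = (l.map fun C => charFunDual η (L.comp C)).prod := by
  induction l with
  | nil => simp [sumLaw, charFunDual_dirac]
  | cons C l ih =>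
    have : IsProbabilityMeasure (η.map C) := isProbabilityMeasure_map (by fun_prop)
    rw [sumLaw, charFunDual_conv, ih, charFunDual_map]
    simp

lemma map_sum_infinitePi (C : ℕ → (Fin d → ℝ) →L[ℝ] E) (n : ℕ) :
    (infinitePi fun _ : ℕ => η).map (fun z => ∑ i ∈ Finset.range n, C i (z i)) =
      sumLaw η ((List.range n).map C) := by
  induction n with
  | zero =>
    simp [sumLaw, Measure.map_const]
  | succ n ih =>
    have hind : iIndepFun (fun (i : ℕ) (z : ℕ → Fin d → ℝ) => C i (z i))
        (infinitePi fun _ : ℕ => η) :=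
      iIndepFun_infinitePi (X := fun i x => C i x) fun i => by fun_prop
    have h1 := hind.indepFun_finsetSum_of_notMem (fun i => by fun_prop)
      (s := Finset.range n) (i := n) (by simp)
    have h2 := h1.map_add_eq_map_conv_map (by fun_prop) (by fun_prop)
    have h3 : (fun z : ℕ → Fin d → ℝ => ∑ i ∈ Finset.range (n + 1), C i (z i)) =
        (∑ j ∈ Finset.range n, fun z : ℕ → Fin d → ℝ => C j (z j)) + fun z => C n (z n) := by
      ext z; simp [Finset.sum_range_succ]
    have h4 : (infinitePi fun _ : ℕ => η).map (fun z => C n (z n)) = sumLaw η [C n] := by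
      have : (fun z : ℕ → Fin d → ℝ => C n (z n)) = C n ∘ fun z => z n := rfl
      have h5 : IsProbabilityMeasure (η.map (C n)) := isProbabilityMeasure_map (by fun_prop)
      rw [this, ← Measure.map_map (by fun_prop) (by fun_prop), infinitePi_map_eval, sumLaw, sumLaw,
        conv_dirac_zero]
    have h6 : (∑ j ∈ Finset.range n, fun z : ℕ → Fin d → ℝ => C j (z j)) =
        fun z => ∑ i ∈ Finset.range n, C i (z i) := by
      ext z; simp
    rw [h3, h2, h4, h6, ih, List.range_succ, List.map_append, sumLaw_append]
    rfl

end SumLaw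

/-! ### The characteristic function -/

section CharFun

variable {d : ℕ}

/-- The linear form `x ↦ ⟨t, x⟩`. -/
def dotCLM (t : Fin d → ℝ) : StrongDual ℝ (Fin d → ℝ) :=
  LinearMap.toContinuousLinearMap
    { toFun := fun x => t ⬝ᵥ x
      map_add' := dotProduct_add t
      map_smul' := fun c x => by simp }

@[simp] lemma dotCLM_apply (t x : Fin d → ℝ) : dotCLM t x = t ⬝ᵥ x := rfl

/-- The continuous linear map `x ↦ a x`. -/
def matCLM (a : Matrix (Fin d) (Fin d) ℝ) : (Fin d → ℝ) →L[ℝ] (Fin d → ℝ) :=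
  LinearMap.toContinuousLinearMap a.mulVecLin

@[simp] lemma matCLM_apply (a : Matrix (Fin d) (Fin d) ℝ) (x : Fin d → ℝ) :
    matCLM a x = a *ᵥ x := rfl

lemma dotCLM_comp_matCLM (t : Fin d → ℝ) (a : Matrix (Fin d) (Fin d) ℝ) :
    (dotCLM t).comp (matCLM a) = dotCLM (aᵀ *ᵥ t) := by
  refine ContinuousLinearMap.ext fun x => ?_
  simp [Matrix.dotProduct_mulVec, Matrix.mulVec_transpose]

/-- The characteristic function `t ↦ E e^{i⟨t,Z⟩}` of a law on `ℝ^d`. -/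
def chf (η : Measure (Fin d → ℝ)) (t : Fin d → ℝ) : ℂ := charFunDual η (dotCLM t)

lemma chf_apply (η : Measure (Fin d → ℝ)) (t : Fin d → ℝ) :
    chf η t = ∫ x, Complex.exp (((t ⬝ᵥ x : ℝ) : ℂ) * Complex.I) ∂η := by
  rw [chf, charFunDual_apply]; rfl

variable (η : Measure (Fin d → ℝ)) [IsProbabilityMeasure η]

lemma norm_chf_le_one (t : Fin d → ℝ) : ‖chf η t‖ ≤ 1 := by
  rw [chf_apply]
  refine (norm_integral_le_of_norm_le_const (C := 1) (ae_of_all _ fun x => ?_)).trans_eq (by simp)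
  rw [Complex.norm_exp_ofReal_mul_I]

lemma continuous_chf : Continuous (chf η) := by
  simp only [funext (chf_apply η)]
  refine continuous_of_dominated (bound := fun _ => 1) (fun t => ?_) (fun t => ?_)
    (integrable_const _) ?_
  · exact Continuous.aestronglyMeasurable (by fun_prop)
  · exact ae_of_all _ fun x => by rw [Complex.norm_exp_ofReal_mul_I]
  · exact ae_of_all _ fun x => by fun_prop

/-- The matrices of the first generation, as a list of linear maps. -/
def childMaps {Ω : Type*} (N : Ω → ℕ) (A : ℕ → Ω → Matrix (Fin d) (Fin d) ℝ) (ω : Ω) :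
    List ((Fin d → ℝ) →L[ℝ] (Fin d → ℝ)) :=
  (List.range (N ω)).map fun i => matCLM (A i ω)

lemma map_smoothing_sum {Ω : Type*} {N : Ω → ℕ} {A : ℕ → Ω → Matrix (Fin d) (Fin d) ℝ} (ω : Ω) :
    (Measure.infinitePi fun _ : ℕ => η).map
        (fun z => ∑ i ∈ Finset.range (N ω), A i ω *ᵥ z i) = sumLaw η (childMaps N A ω) :=
  map_sum_infinitePi η (fun i => matCLM (A i ω)) (N ω)

end CharFun

/-! ### The fixed point equation -/

section FixedPoint

variable {Ω : Type*} [MeasurableSpace Ω] {d : ℕ} {P : Measure Ω}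
  {N : Ω → ℕ} {A : ℕ → Ω → Matrix (Fin d) (Fin d) ℝ}
  {η : Measure (Fin d → ℝ)} [IsProbabilityMeasure η]

lemma measurable_smoothing_sum (hN : Measurable N) (hA : ∀ i, Measurable (A i)) :
    Measurable fun p : Ω × (ℕ → Fin d → ℝ) => ∑ i ∈ Finset.range (N p.1), A i p.1 *ᵥ p.2 i := by
  have h1 : ∀ i, Measurable fun p : Ω × (ℕ → Fin d → ℝ) => A i p.1 *ᵥ p.2 i := by
    intro i
    refine measurable_pi_iff.2 fun j => ?_
    simp only [Matrix.mulVec, dotProduct]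
    refine Finset.measurable_sum _ fun k _ => Measurable.mul ?_ ?_
    · exact (measurable_pi_apply k).comp
        ((measurable_pi_apply j).comp ((hA i).comp measurable_fst))
    · exact (measurable_pi_apply k).comp ((measurable_pi_apply i).comp measurable_snd)
  have h2 : Measurable fun q : ℕ × (Ω × (ℕ → Fin d → ℝ)) =>
      ∑ i ∈ Finset.range q.1, A i q.2.1 *ᵥ q.2.2 i :=
    measurable_from_prod_countable_right fun n =>
      Finset.measurable_sum (Finset.range n) fun i _ => h1 i
  exact h2.comp ((hN.comp measurable_fst).prodMk measurable_id)

lemma lintegral_fixed (hN : Measurable N) (hA : ∀ i, Measurable (A i))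
    (hfix : smoothingTransform P N A η = η) {g : (Fin d → ℝ) → ℝ≥0∞} (hg : Measurable g) :
    ∫⁻ x, g x ∂η = ∫⁻ ω, ∫⁻ x, g x ∂(sumLaw η (childMaps N A ω)) ∂P := by
  have hm := measurable_smoothing_sum hN hA
  conv_lhs => rw [← hfix]
  rw [smoothingTransform, lintegral_map hg hm, lintegral_prod _ (by exact (hg.comp hm).aemeasurable)]
  refine lintegral_congr fun ω => ?_
  rw [← map_smoothing_sum η ω, lintegral_map hg]
  exact hm.comp measurable_prodMk_left

lemma chf_fixed [IsProbabilityMeasure P] (hN : Measurable N) (hA : ∀ i, Measurable (A i))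
    (hfix : smoothingTransform P N A η = η) (t : Fin d → ℝ) :
    chf η t = ∫ ω, ∏ i ∈ Finset.range (N ω), chf η ((A i ω)ᵀ *ᵥ t) ∂P := by
  have hm := measurable_smoothing_sum hN hA
  have hc : Continuous fun x : Fin d → ℝ => Complex.exp (((t ⬝ᵥ x : ℝ) : ℂ) * Complex.I) := by
    fun_prop
  have hinteg : Integrable (fun p : Ω × (ℕ → Fin d → ℝ) => Complex.exp
      (((t ⬝ᵥ ∑ i ∈ Finset.range (N p.1), A i p.1 *ᵥ p.2 i : ℝ) : ℂ) * Complex.I))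
      (P.prod (Measure.infinitePi fun _ : ℕ => η)) := by
    refine (integrable_const (1 : ℝ)).mono' ((hc.measurable.comp hm).aestronglyMeasurable) ?_
    exact ae_of_all _ fun p => by rw [Complex.norm_exp_ofReal_mul_I]
  rw [chf_apply]
  conv_lhs => rw [← hfix]
  rw [smoothingTransform, integral_map hm.aemeasurable hc.aestronglyMeasurable, integral_prod _ hinteg]
  refine integral_congr_ae (ae_of_all _ fun ω => ?_)
  have h1 : ∫ z, Complex.exp (((t ⬝ᵥ ∑ i ∈ Finset.range (N ω), A i ω *ᵥ z i : ℝ) : ℂ) * Complex.I)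
      ∂(Measure.infinitePi fun _ : ℕ => η) = chf (sumLaw η (childMaps N A ω)) t := by
    rw [chf_apply, ← map_smoothing_sum η ω, integral_map
      (by exact (hm.comp measurable_prodMk_left).aemeasurable) hc.aestronglyMeasurable]
  simp only [h1, chf, charFunDual_sumLaw, childMaps, List.map_map, Function.comp_def,
    dotCLM_comp_matCLM]
  rw [Finset.prod_range, ← List.prod_ofFn]
  congr 1
  rw [List.ofFn_eq_map, ← List.map_coe_finRange_eq_range, List.map_map]
  rfl

lemma measurable_norm_chf_transpose {a : Ω → Matrix (Fin d) (Fin d) ℝ} (ha : Measurable a)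
    (t : Fin d → ℝ) : Measurable fun ω => ‖chf η ((a ω)ᵀ *ᵥ t)‖ :=
  (continuous_chf η).norm.measurable.comp ((measurable_transpose_mulVec_const t).comp ha)

lemma norm_chf_le [IsProbabilityMeasure P] (hN : Measurable N) (hA : ∀ i, Measurable (A i))
    (hfix : smoothingTransform P N A η = η) (t : Fin d → ℝ) :
    ‖chf η t‖ ≤ ∫ ω, ∏ i ∈ Finset.range (N ω), ‖chf η ((A i ω)ᵀ *ᵥ t)‖ ∂P := by
  rw [chf_fixed hN hA hfix t]
  refine (norm_integral_le_integral_norm _).trans_eq ?_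
  simp only [norm_prod]

end FixedPoint

/-! ### Following a random child, and the event of two large children -/

section Children

variable {Ω : Type*} [MeasurableSpace Ω] {d : ℕ} {P : Measure Ω}
  {N : Ω → ℕ} {A : ℕ → Ω → Matrix (Fin d) (Fin d) ℝ}

/-- A random vector `T`, to be thought of as `A_jᵀ t` for a random index `j`, along which `h` does
not decrease in mean, the Lyapunov function `w` contracts, and a negative moment is controlled. -/
structure ChildStep (P : Measure Ω) (h w : (Fin d → ℝ) → ℝ) (ρ ε C : ℝ) (t : Fin d → ℝ)
    (T : Ω → Fin d → ℝ) : Prop where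
  measurable : Measurable T
  ne_zero : ∀ᵐ ω ∂P, T ω ≠ 0
  integrable_lyapunov : Integrable (fun ω => w (T ω)) P
  integral_lyapunov_le : ∫ ω, w (T ω) ∂P ≤ ρ * w t
  integrable_rpow : Integrable (fun ω => l1norm (T ω) ^ (-ε)) P
  integral_rpow_le : ∫ ω, l1norm (T ω) ^ (-ε) ∂P ≤ C * l1norm t ^ (-ε)
  le_integral : h t ≤ ∫ ω, h (T ω) ∂P

lemma measurable_select (hA : ∀ i, Measurable (A i)) {j : Ω → ℕ} (hj : Measurable j) :
    Measurable fun ω => A (j ω) ω := by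
  have h2 : Measurable fun q : ℕ × Ω => A q.1 q.2 := measurable_from_prod_countable_right hA
  exact h2.comp (hj.prodMk measurable_id)

lemma integrable_and_integral_le_of_lintegral_le {f : Ω → ℝ} (hf : AEStronglyMeasurable f P)
    (h0 : 0 ≤ᵐ[P] f) {c : ℝ} (hc : 0 ≤ c) (h : ∫⁻ ω, ENNReal.ofReal (f ω) ∂P ≤ ENNReal.ofReal c) :
    Integrable f P ∧ ∫ ω, f ω ∂P ≤ c := by
  refine ⟨⟨hf, (hasFiniteIntegral_iff_ofReal h0).2 (h.trans_lt ENNReal.ofReal_lt_top)⟩, ?_⟩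
  rw [integral_eq_lintegral_of_nonneg_ae h0 hf]
  exact ENNReal.toReal_le_of_le_ofReal hc h

lemma transpose_mulVec_smul_normalize (a : Matrix (Fin d) (Fin d) ℝ) {t : Fin d → ℝ} (ht : t ≠ 0) :
    aᵀ *ᵥ t = l1norm t • aᵀ *ᵥ ((l1norm t)⁻¹ • t) := by
  rw [Matrix.mulVec_smul, smul_smul, mul_inv_cancel₀ (l1norm_pos ht).ne', one_smul]

lemma l1norm_normalize {t : Fin d → ℝ} (ht : t ≠ 0) : l1norm ((l1norm t)⁻¹ • t) = 1 := by
  rw [l1norm_smul, abs_inv, abs_of_pos (l1norm_pos ht), inv_mul_cancel₀ (l1norm_pos ht).ne']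

/-- The index is the one that (C) attaches to t/|t|, and homogeneity transfers its negative moment
to t. It lies below N because later matrices vanish. Dropping the other children from the Lyapunov
sum, and their factors of modulus at most one from the product, gives the other bounds. -/
lemma exists_childStep [IsProbabilityMeasure P] {η : Measure (Fin d → ℝ)} [IsProbabilityMeasure η]
    (hN : Measurable N) (hA : ∀ i, Measurable (A i))
    (hb : BranchingCondition P N A) (hact : ActivityCondition P A)
    (hfix : smoothingTransform P N A η = η)
    {ρ : ℝ} {w : (Fin d → ℝ) → ℝ} (hρ : 0 < ρ) (hwm : Measurable w) (hw0 : ∀ t, 0 ≤ w t)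
    (hw : ∀ t, ∫⁻ ω, ∑ i ∈ Finset.range (N ω), ENNReal.ofReal (w ((A i ω)ᵀ *ᵥ t)) ∂P
        ≤ ENNReal.ofReal (ρ * w t)) :
    ∃ ε C : ℝ, 0 < ε ∧ 0 < C ∧ ∀ t ≠ 0, ∃ j : Ω → ℕ, (∀ᵐ ω ∂P, j ω < N ω) ∧
      ChildStep P (fun t => ‖chf η t‖) w ρ ε C t fun ω => (A (j ω) ω)ᵀ *ᵥ t := by
  obtain ⟨ε, hε, i, hi, hsup⟩ := hact.harmonic
  set S := ⨆ t ∈ {t : Fin d → ℝ | l1norm t = 1},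
      ∫⁻ ω, ENNReal.ofReal (l1norm ((A (i t ω) ω)ᵀ *ᵥ t)) ^ (-ε) ∂P
  -- The added 1 makes the constant positive.
  refine ⟨ε, S.toReal + 1, hε, by positivity, fun t ht => ?_⟩
  have htpos := l1norm_pos ht
  set u := (l1norm t)⁻¹ • t
  have hu : l1norm u = 1 := l1norm_normalize ht
  obtain ⟨hjm, hju⟩ := hi u hu
  have hTu : ∀ ω, (A (i u ω) ω)ᵀ *ᵥ t = l1norm t • (A (i u ω) ω)ᵀ *ᵥ u := fun ω =>
    transpose_mulVec_smul_normalize _ ht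
  have hTm : Measurable fun ω => (A (i u ω) ω)ᵀ *ᵥ t :=
    (measurable_transpose_mulVec_const t).comp (measurable_select hA hjm)
  have hne : ∀ᵐ ω ∂P, (A (i u ω) ω)ᵀ *ᵥ t ≠ 0 := by
    filter_upwards [hju] with ω hω
    rw [hTu]
    exact smul_ne_zero htpos.ne' hω
  have hlt : ∀ᵐ ω ∂P, i u ω < N ω := by
    filter_upwards [hb.eq_zero, hne] with ω h1 h2
    by_contra hcon
    rw [h1 _ (not_lt.1 hcon)] at h2
    simp at h2
  have hwT := integrable_and_integral_le_of_lintegral_le (P := P)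
    (f := fun ω => w ((A (i u ω) ω)ᵀ *ᵥ t)) (c := ρ * w t)
    (hwm.comp hTm).aestronglyMeasurable (ae_of_all _ fun ω => hw0 _)
    (mul_nonneg hρ.le (hw0 t)) <| by
      refine le_trans (lintegral_mono_ae ?_) (hw t)
      filter_upwards [hlt] with ω hω
      exact Finset.single_le_sum (f := fun k => ENNReal.ofReal (w ((A k ω)ᵀ *ᵥ t)))
        (fun _ _ => zero_le) (Finset.mem_range.2 hω)
  have hneg := integrable_and_integral_le_of_lintegral_le (P := P)
    (f := fun ω => l1norm ((A (i u ω) ω)ᵀ *ᵥ t) ^ (-ε)) (c := (S.toReal + 1) * l1norm t ^ (-ε))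
    ((continuous_l1norm.measurable.comp hTm).pow_const (-ε)).aestronglyMeasurable
    (ae_of_all _ fun ω => Real.rpow_nonneg (l1norm_nonneg _) _) (by positivity) <| by
      have h1 : ∀ᵐ ω ∂P, ENNReal.ofReal (l1norm ((A (i u ω) ω)ᵀ *ᵥ t) ^ (-ε)) =
          ENNReal.ofReal (l1norm t ^ (-ε)) *
            ENNReal.ofReal (l1norm ((A (i u ω) ω)ᵀ *ᵥ u)) ^ (-ε) := by
        filter_upwards [hju] with ω hω
        rw [ENNReal.ofReal_rpow_of_pos (l1norm_pos hω), ← ENNReal.ofReal_mul (by positivity), hTu,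
          l1norm_smul, abs_of_pos htpos, Real.mul_rpow htpos.le (l1norm_nonneg _)]
      rw [lintegral_congr_ae h1, lintegral_const_mul' _ _ ENNReal.ofReal_ne_top, mul_comm,
        ENNReal.ofReal_mul (by positivity)]
      gcongr
      calc _ ≤ S := le_iSup₂ (f := fun (t : Fin d → ℝ) (_ : t ∈ {t : Fin d → ℝ | l1norm t = 1}) =>
              ∫⁻ ω, ENNReal.ofReal (l1norm ((A (i t ω) ω)ᵀ *ᵥ t)) ^ (-ε) ∂P) u hu
        _ = ENNReal.ofReal S.toReal := (ENNReal.ofReal_toReal hsup.ne).symm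
        _ ≤ _ := ENNReal.ofReal_le_ofReal (by linarith)
  refine ⟨i u, hlt, hTm, hne, hwT.1, hwT.2, hneg.1, hneg.2, ?_⟩
  refine (norm_chf_le hN hA hfix t).trans (integral_mono_of_nonneg
    (ae_of_all _ fun ω => Finset.prod_nonneg fun _ _ => norm_nonneg _) ?_ ?_)
  · refine (integrable_const (1 : ℝ)).mono' ?_ (ae_of_all _ fun ω => ?_)
    · exact (measurable_norm_chf_transpose (measurable_select hA hjm) t).aestronglyMeasurable
    · rw [norm_norm]
      exact norm_chf_le_one η _
  · filter_upwards [hlt] with ω hω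
    rw [← Finset.mul_prod_erase _ _ (Finset.mem_range.2 hω)]
    exact mul_le_of_le_one_right (norm_nonneg _)
      (Finset.prod_le_one (fun _ _ => norm_nonneg _) fun _ _ => norm_chf_le_one η _)

/-- The event that at least two of the vectors `A_iᵀ t` have norm at least one. -/
def twoLarge {Ω : Type*} (A : ℕ → Ω → Matrix (Fin d) (Fin d) ℝ) (t : Fin d → ℝ) : Set Ω :=
  {ω | ∃ i j, i ≠ j ∧ 1 ≤ l1norm ((A i ω)ᵀ *ᵥ t) ∧ 1 ≤ l1norm ((A j ω)ᵀ *ᵥ t)}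

lemma measurableSet_twoLarge (hA : ∀ i, Measurable (A i)) (t : Fin d → ℝ) :
    MeasurableSet (twoLarge A t) := by
  have h1 : ∀ i, MeasurableSet {ω | 1 ≤ l1norm ((A i ω)ᵀ *ᵥ t)} := fun i =>
    measurableSet_le measurable_const
      (continuous_l1norm.measurable.comp ((measurable_transpose_mulVec_const t).comp (hA i)))
  have : twoLarge A t = ⋃ i, ⋃ j, ⋃ _ : i ≠ j, {ω | 1 ≤ l1norm ((A i ω)ᵀ *ᵥ t)} ∩
      {ω | 1 ≤ l1norm ((A j ω)ᵀ *ᵥ t)} := by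
    ext ω; simp only [twoLarge, Set.mem_ofPred_eq, Set.mem_iUnion, Set.mem_inter_iff, exists_prop]
  rw [this]
  exact MeasurableSet.iUnion fun i => MeasurableSet.iUnion fun j => MeasurableSet.iUnion fun _ =>
    (h1 i).inter (h1 j)

lemma isCompact_l1_annulus (a b : ℝ) :
    IsCompact {t : Fin d → ℝ | a ≤ l1norm t ∧ l1norm t ≤ b} := by
  refine Metric.isCompact_of_isClosed_isBounded ?_ ?_
  · exact (isClosed_le continuous_const continuous_l1norm).inter
      (isClosed_le continuous_l1norm continuous_const)
  · refine (Metric.isBounded_closedBall (x := (0 : Fin d → ℝ)) (r := b)).subset fun t ht => ?_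
    rw [mem_closedBall_zero_iff]
    refine le_trans ?_ ht.2
    refine (pi_norm_le_iff_of_nonneg (l1norm_nonneg t)).2 fun i => ?_
    exact Finset.single_le_sum (f := fun i => |t i|) (fun _ _ => abs_nonneg _) (Finset.mem_univ i)

/-- Compactness of directions. Were the probabilities not bounded below, there would be t_n with
|t_n| → ∞, directions converging to u, and probabilities tending to zero. Any two indices active at
u eventually give large vectors at t_n, so {N(u) ≥ 2} lies in a liminf of these events, which is
null; this contradicts P[N(u) = 1] < 1. -/
lemma exists_le_measure_twoLarge [IsProbabilityMeasure P] (hact : ActivityCondition P A) :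
    ∃ p R : ℝ, 0 < p ∧ 1 ≤ R ∧ ∀ t, R ≤ l1norm t → ENNReal.ofReal p ≤ P (twoLarge A t) := by
  by_contra! hcon
  have hex : ∀ n : ℕ, ∃ t : Fin d → ℝ, (n : ℝ) + 1 ≤ l1norm t ∧
      P (twoLarge A t) < ENNReal.ofReal (1 / ((n : ℝ) + 1)) := fun n =>
    hcon (1 / ((n : ℝ) + 1)) (n + 1) (by positivity) (by linarith [n.cast_nonneg (α := ℝ)])
  choose t ht1 ht2 using hex
  have ht0 : ∀ n, t n ≠ 0 := fun n h0 => by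
    have := ht1 n
    rw [l1norm_eq_zero.2 h0] at this
    linarith [n.cast_nonneg (α := ℝ)]
  have hu : ∀ n, (l1norm (t n))⁻¹ • t n ∈ {t : Fin d → ℝ | 1 ≤ l1norm t ∧ l1norm t ≤ 1} := fun n => by
    simp [l1norm_normalize (ht0 n)]
  obtain ⟨u, hu1, φ, hφ, hlim⟩ := (isCompact_l1_annulus 1 1).tendsto_subseq hu
  have hu0 : u ≠ 0 := fun h0 => by
    have := hu1.1
    rw [l1norm_eq_zero.2 h0] at this
    linarith
  have hlarge : ∀ a : Matrix (Fin d) (Fin d) ℝ, aᵀ *ᵥ u ≠ 0 →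
      ∀ᶠ n in atTop, 1 ≤ l1norm (aᵀ *ᵥ t (φ n)) := by
    intro a ha
    have h1 : Tendsto (fun n => l1norm (aᵀ *ᵥ ((l1norm (t (φ n)))⁻¹ • t (φ n)))) atTop
        (𝓝 (l1norm (aᵀ *ᵥ u))) :=
      ((continuous_l1norm.comp (Continuous.matrix_mulVec continuous_const continuous_id)).tendsto
        u).comp hlim
    have h2 : Tendsto (fun n => l1norm (t (φ n))) atTop atTop := by
      refine tendsto_atTop_mono (f := fun n => ((φ n : ℕ) : ℝ)) (fun n => ?_)
        (tendsto_natCast_atTop_atTop.comp hφ.tendsto_atTop)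
      linarith [ht1 (φ n)]
    have h3 := h2.atTop_mul_pos (l1norm_pos ha) h1
    filter_upwards [h3.eventually_ge_atTop 1] with n hn
    rwa [transpose_mulVec_smul_normalize a (ht0 (φ n)), l1norm_smul,
      abs_of_pos (l1norm_pos (ht0 _))]
  have hnull : P (⋃ k, ⋂ n ≥ k, twoLarge A (t (φ n))) = 0 := by
    refine measure_iUnion_null fun k => ?_
    have h1 : Tendsto (fun n : ℕ => ENNReal.ofReal (1 / (((φ n : ℕ) : ℝ) + 1))) atTop (𝓝 0) := by
      have := (tendsto_one_div_add_atTop_nhds_zero_nat (𝕜 := ℝ)).comp hφ.tendsto_atTop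
      simpa using ENNReal.tendsto_ofReal this
    refine le_antisymm (ge_of_tendsto h1 ?_) zero_le
    filter_upwards [eventually_ge_atTop k] with n hn
    exact (measure_mono (Set.biInter_subset_of_mem hn)).trans (ht2 (φ n)).le
  refine (hact.prob_lt_one u hu0).ne ?_
  rw [← measure_univ (μ := P)]
  refine measure_congr (eventuallyEq_univ.2 ?_)
  filter_upwards [hact.one_le, compl_mem_ae_iff.2 hnull] with ω h1 h2
  by_contra hne
  obtain ⟨i, j, hi, hj, hij⟩ := Set.one_lt_encard_iff.1 ((h1 u hu0).lt_of_ne (Ne.symm hne))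
  refine h2 ?_
  obtain ⟨k, hk⟩ := eventually_atTop.1 ((hlarge _ hi).and (hlarge _ hj))
  exact Set.mem_iUnion.2 ⟨k, Set.mem_iInter₂.2 fun n hn => ⟨i, j, hij, hk n hn⟩⟩

end Children

/-! ### The characteristic function is bounded away from one -/

section Unimodular

variable {Ω : Type*} [MeasurableSpace Ω] {d : ℕ} {P : Measure Ω} [IsProbabilityMeasure P]
  {h w : (Fin d → ℝ) → ℝ} {ρ ε C : ℝ}

lemma integrable_comp_childStep {t : Fin d → ℝ} {T : Ω → Fin d → ℝ} (hcont : Continuous h)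
    (h0 : ∀ t, 0 ≤ h t) (h1 : ∀ t, h t ≤ 1) (hT : ChildStep P h w ρ ε C t T) :
    Integrable (fun ω => h (T ω)) P := by
  refine (integrable_const (1 : ℝ)).mono'
    (hcont.measurable.comp hT.measurable).aestronglyMeasurable (ae_of_all _ fun ω => ?_)
  rw [Real.norm_of_nonneg (h0 _)]
  exact h1 _

/-- Equality in 1 = h(t) ≤ E h(T) ≤ 1 forces h(T) = 1 almost surely, and on any set of full measure
some outcome has w(T) at most its mean. -/
lemma exists_contracted_of_eq_one (hcont : Continuous h) (h0 : ∀ t, 0 ≤ h t) (h1 : ∀ t, h t ≤ 1)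
    {t : Fin d → ℝ} {T : Ω → Fin d → ℝ} (hT : ChildStep P h w ρ ε C t T) (ht : h t = 1) :
    ∃ t' ≠ 0, h t' = 1 ∧ w t' ≤ ρ * w t := by
  have hinteg := integrable_comp_childStep hcont h0 h1 hT
  have hzero : ∫ ω, (1 - h (T ω)) ∂P = 0 := by
    refine le_antisymm ?_ (integral_nonneg fun ω => sub_nonneg.2 (h1 _))
    rw [integral_sub (integrable_const _) hinteg]
    have := hT.le_integral
    simp only [integral_const, probReal_univ, smul_eq_mul, mul_one]
    linarith
  rw [integral_eq_zero_iff_of_nonneg (fun ω => sub_nonneg.2 (h1 _))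
    ((integrable_const _).sub hinteg)] at hzero
  have hae : ∀ᵐ ω ∂P, T ω ≠ 0 ∧ h (T ω) = 1 := by
    filter_upwards [hT.ne_zero, hzero] with ω h2 h3
    simp only [Pi.zero_apply] at h3
    exact ⟨h2, by linarith⟩
  obtain ⟨ω, hω, hle⟩ := exists_notMem_null_le_integral hT.integrable_lyapunov hae
  simp only [Set.mem_compl_iff, Set.mem_ofPred_eq, not_not] at hω
  exact ⟨T ω, hω.1, hω.2, hle.trans hT.integral_lyapunov_le⟩

lemma exists_seq_of_eq_one {s : ℝ} (hs : 0 < s) (hρ0 : 0 < ρ) (hρ : ρ < 1)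
    (hw1 : ∀ t, l1norm t ^ s ≤ w t)
    (hcont : Continuous h) (h0 : ∀ t, 0 ≤ h t) (h1 : ∀ t, h t ≤ 1)
    (hstep : ∀ t ≠ 0, ∃ T, ChildStep P h w ρ ε C t T) {t₀ : Fin d → ℝ} (ht₀ : t₀ ≠ 0)
    (hh : h t₀ = 1) :
    ∃ t : ℕ → Fin d → ℝ, (∀ n, t n ≠ 0 ∧ h (t n) = 1) ∧
      Tendsto (fun n => l1norm (t n)) atTop (𝓝 0) := by
  have hnext : ∀ t : {t : Fin d → ℝ // t ≠ 0 ∧ h t = 1},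
      ∃ t' : {t : Fin d → ℝ // t ≠ 0 ∧ h t = 1}, w t' ≤ ρ * w t := by
    rintro ⟨t, ht, hht⟩
    obtain ⟨T, hT⟩ := hstep t ht
    obtain ⟨t', h2, h3, h4⟩ := exists_contracted_of_eq_one hcont h0 h1 hT hht
    exact ⟨⟨t', h2, h3⟩, h4⟩
  choose f hf using hnext
  have hw : ∀ n, w (f^[n] ⟨t₀, ht₀, hh⟩) ≤ ρ ^ n * w t₀ := by
    intro n
    induction n with
    | zero => simp
    | succ n ih =>
      rw [Function.iterate_succ_apply', pow_succ', mul_assoc]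
      exact (hf _).trans (mul_le_mul_of_nonneg_left ih hρ0.le)
  refine ⟨fun n => f^[n] ⟨t₀, ht₀, hh⟩, fun n => (f^[n] ⟨t₀, ht₀, hh⟩).2, ?_⟩
  have hz : Tendsto (fun n : ℕ => ρ ^ n * w t₀) atTop (𝓝 0) := by
    simpa using (tendsto_pow_atTop_nhds_zero_of_lt_one hρ0.le hρ).mul_const (w t₀)
  have hpow : Tendsto (fun n : ℕ => (ρ ^ n * w t₀) ^ (1 / s)) atTop (𝓝 0) := by
    have := hz.rpow_const (p := 1 / s) (Or.inr (by positivity))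
    rwa [Real.zero_rpow (by positivity)] at this
  refine squeeze_zero (fun n => l1norm_nonneg _) (fun n => ?_) hpow
  have h2 := (hw1 (f^[n] ⟨t₀, ht₀, hh⟩)).trans (hw n)
  have h3 := Real.rpow_le_rpow (Real.rpow_nonneg (l1norm_nonneg _) _) h2 (z := 1 / s) (by positivity)
  rwa [← Real.rpow_mul (l1norm_nonneg _), mul_one_div_cancel hs.ne', Real.rpow_one] at h3

end Unimodular

/-! ### Modulus one arbitrarily close to the origin forces degeneracy -/

section NonDegenerate

variable {d : ℕ} {η : Measure (Fin d → ℝ)} [IsProbabilityMeasure η]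

lemma ae_exp_eq_of_norm_chf_eq_one {t : Fin d → ℝ} (ht : ‖chf η t‖ = 1) :
    ∀ᵐ x ∂η, Complex.exp (((t ⬝ᵥ x : ℝ) : ℂ) * Complex.I) = chf η t := by
  have hle : ∀ᵐ x ∂η, ‖Complex.exp (((t ⬝ᵥ x : ℝ) : ℂ) * Complex.I)‖ ≤ 1 :=
    ae_of_all _ fun x => by rw [Complex.norm_exp_ofReal_mul_I]
  rcases ae_eq_const_or_norm_integral_lt_of_norm_le_const hle with h | h
  · filter_upwards [h] with x hx
    rw [hx, Function.const_apply, average_eq_integral, chf_apply]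
  · rw [← chf_apply, ht] at h
    simp at h

/-- For x, x₀ in a set of full measure, ⟨t_n, x - x₀⟩ is a multiple of 2π tending to zero, hence
eventually exactly zero. The rank may depend on x, but the limit u of the directions does not. -/
lemma exists_dotProduct_ae_const {t : ℕ → Fin d → ℝ} (ht : ∀ n, t n ≠ 0 ∧ ‖chf η (t n)‖ = 1)
    (hlim : Tendsto (fun n => l1norm (t n)) atTop (𝓝 0)) :
    ∃ u : Fin d → ℝ, u ≠ 0 ∧ ∃ c : ℝ, ∀ᵐ x ∂η, u ⬝ᵥ x = c := by
  have hae : ∀ᵐ x ∂η, ∀ n, Complex.exp (((t n ⬝ᵥ x : ℝ) : ℂ) * Complex.I) = chf η (t n) :=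
    ae_all_iff.2 fun n => ae_exp_eq_of_norm_chf_eq_one (ht n).2
  obtain ⟨x₀, hx₀⟩ := hae.exists
  have hu : ∀ n, (l1norm (t n))⁻¹ • t n ∈ {t : Fin d → ℝ | 1 ≤ l1norm t ∧ l1norm t ≤ 1} := fun n => by
    simp [l1norm_normalize (ht n).1]
  obtain ⟨u, hu1, φ, hφ, hlimu⟩ := (isCompact_l1_annulus 1 1).tendsto_subseq hu
  refine ⟨u, fun hu0 => ?_, u ⬝ᵥ x₀, ?_⟩
  · have := hu1.1
    rw [l1norm_eq_zero.2 hu0] at this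
    linarith
  filter_upwards [hae] with x hx
  have hev : ∀ᶠ n in atTop, t n ⬝ᵥ (x - x₀) = 0 := by
    have h1 : Tendsto (fun n => l1norm (t n) * l1norm (x - x₀)) atTop (𝓝 0) := by
      simpa using hlim.mul_const (l1norm (x - x₀))
    filter_upwards [h1.eventually (eventually_lt_nhds Real.two_pi_pos)] with n hn
    have h2 : Complex.exp (((t n ⬝ᵥ x : ℝ) : ℂ) * Complex.I) =
        Complex.exp (((t n ⬝ᵥ x₀ : ℝ) : ℂ) * Complex.I) := (hx n).trans (hx₀ n).symm
    obtain ⟨k, hk⟩ := Complex.exp_eq_exp_iff_exists_int.1 h2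
    have h3 : t n ⬝ᵥ (x - x₀) = k * (2 * Real.pi) := by
      have h4 : ((t n ⬝ᵥ x : ℝ) : ℂ) = ((t n ⬝ᵥ x₀ + k * (2 * Real.pi) : ℝ) : ℂ) := by
        have h5 : ((t n ⬝ᵥ x : ℝ) : ℂ) * Complex.I =
            ((t n ⬝ᵥ x₀ + k * (2 * Real.pi) : ℝ) : ℂ) * Complex.I := by
          rw [hk]; push_cast; ring
        exact mul_right_cancel₀ Complex.I_ne_zero h5
      have := Complex.ofReal_injective h4
      rw [dotProduct_sub, this]; ring
    have h4 : |t n ⬝ᵥ (x - x₀)| < 2 * Real.pi := (abs_dotProduct_le _ _).trans_lt hn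
    rw [h3, abs_mul, abs_of_pos Real.two_pi_pos] at h4
    have h5 : |(k : ℝ)| < 1 := by
      have := Real.two_pi_pos
      by_contra! h6
      nlinarith
    have h6 : k = 0 := by
      have : |k| < 1 := by exact_mod_cast h5
      exact Int.abs_lt_one_iff.1 this
    rw [h3, h6]; simp
  have hlim2 : Tendsto (fun n => ((l1norm (t (φ n)))⁻¹ • t (φ n)) ⬝ᵥ (x - x₀)) atTop
      (𝓝 (u ⬝ᵥ (x - x₀))) :=
    ((continuous_id.dotProduct continuous_const).tendsto u).comp hlimu
  have hlim3 : Tendsto (fun n => ((l1norm (t (φ n)))⁻¹ • t (φ n)) ⬝ᵥ (x - x₀)) atTop (𝓝 0) := by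
    refine tendsto_const_nhds.congr' ?_
    filter_upwards [hφ.tendsto_atTop.eventually hev] with n hn
    rw [smul_dotProduct, hn, smul_zero]
  have := tendsto_nhds_unique hlim2 hlim3
  rw [dotProduct_sub] at this
  linarith

end NonDegenerate

/-! ### Uniform gap -/

section Gap

variable {Ω : Type*} [MeasurableSpace Ω] {d : ℕ} {P : Measure Ω} [IsProbabilityMeasure P]
  {h w : (Fin d → ℝ) → ℝ} {ρ ε C : ℝ}

/-- Tangent line at y of the convex function x ↦ x^{-θ}. Integrating it replaces Jensen's inequality
and needs integrability of w(T) only. -/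
lemma rpow_neg_tangent {x y θ : ℝ} (hx : 0 < x) (hy : 0 < y) (hθ : 0 < θ) :
    y ^ (-θ) * (1 + θ) - θ * (y ^ (-θ) / y) * x ≤ x ^ (-θ) := by
  have h1 : x ^ (-θ) = y ^ (-θ) * Real.exp (-θ * Real.log (x / y)) := by
    rw [Real.rpow_def_of_pos hx, Real.rpow_def_of_pos hy, ← Real.exp_add,
      Real.log_div hx.ne' hy.ne']
    ring_nf
  have h2 := Real.add_one_le_exp (-θ * Real.log (x / y))
  have h3 := Real.log_le_sub_one_of_pos (div_pos hx hy)
  have h4 : 1 - θ * (x / y - 1) ≤ Real.exp (-θ * Real.log (x / y)) := by nlinarith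
  rw [h1]
  refine le_trans (le_of_eq ?_) (mul_le_mul_of_nonneg_left h4 (by positivity))
  ring

/-- One step of a minimum principle. Here 1 - h(t) is at least the mean of 1 - h(T), while the
barrier 1 + w^{-θ} - κw increases in mean: by convexity w^{-θ} gains θ(1 - ρ)w^{-θ}, and -κw gains
κ(1 - ρ)w. The first gain pays for outcomes with |T| < 1 through `hbig`; the second improves the
lower bound -M. -/
lemma gap_step {s θ κ c M : ℝ} (hs : 0 < s) (hθ : 0 < θ) (hθε : s * θ ≤ ε) (hκ : 0 < κ) (hc : 0 < c)
    (hM : 0 ≤ M) (hw1 : ∀ t, l1norm t ^ s ≤ w t) (hcont : Continuous h) (h0 : ∀ t, 0 ≤ h t)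
    (h1 : ∀ t, h t ≤ 1)
    (hF : ∀ t, 1 ≤ l1norm t → -M ≤ 1 - h t - c * (1 + w t ^ (-θ) - κ * w t))
    {t : Fin d → ℝ} {T : Ω → Fin d → ℝ} (ht : t ≠ 0) (hT : ChildStep P h w ρ ε C t T)
    (hbig : 2 * C * l1norm t ^ (-ε) ≤ θ * (1 - ρ) * w t ^ (-θ)) :
    -M + c * κ * (1 - ρ) * w t ≤ 1 - h t - c * (1 + w t ^ (-θ) - κ * w t) := by
  have hwpos : ∀ t ≠ 0, 0 < w t := fun t ht =>
    (Real.rpow_pos_of_pos (l1norm_pos ht) s).trans_le (hw1 t)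
  set y := w t
  have hy : 0 < y := hwpos t ht
  set Y := y ^ (-θ)
  have hpt : ∀ᵐ ω ∂P, h (T ω) ≤ (1 - c * (1 + Y * (1 + θ)) + M)
      + c * (θ * (Y / y) + κ) * w (T ω) + 2 * c * l1norm (T ω) ^ (-ε) := by
    filter_upwards [hT.ne_zero] with ω hω
    have hx := hwpos _ hω
    have hl := l1norm_pos hω
    have htan := mul_le_mul_of_nonneg_left (rpow_neg_tangent hx hy hθ) hc.le
    have hlneg : 0 < l1norm (T ω) ^ (-ε) := by positivity
    by_cases hcase : 1 ≤ l1norm (T ω)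
    · have := hF _ hcase
      nlinarith
    -- Inside the unit ball `hF` says nothing; there both 1 and w(T)^{-θ} are at most |T|^{-ε},
    -- which accounts for the term 2c|T|^{-ε}.
    · push Not at hcase
      have e1 : 1 ≤ l1norm (T ω) ^ (-ε) :=
        Real.one_le_rpow_of_pos_of_le_one_of_nonpos hl hcase.le (by nlinarith)
      have e2 : w (T ω) ^ (-θ) ≤ l1norm (T ω) ^ (-ε) := by
        calc w (T ω) ^ (-θ) ≤ (l1norm (T ω) ^ s) ^ (-θ) :=
              Real.rpow_le_rpow_of_nonpos (by positivity) (hw1 _) (by linarith)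
          _ = l1norm (T ω) ^ (-(s * θ)) := by rw [← Real.rpow_mul hl.le]; ring_nf
          _ ≤ _ := Real.rpow_le_rpow_of_exponent_ge hl hcase.le (by linarith)
      have e3 := h1 (T ω)
      have e4 : 0 ≤ c * κ * w (T ω) := by positivity
      nlinarith
  have hI1 := hT.integrable_lyapunov.const_mul (c * (θ * (Y / y) + κ))
  have hI2 := hT.integrable_rpow.const_mul (2 * c)
  have hI0 : Integrable (fun _ : Ω => 1 - c * (1 + Y * (1 + θ)) + M) P := integrable_const _
  have hI01 : Integrable (fun ω => 1 - c * (1 + Y * (1 + θ)) + M +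
      c * (θ * (Y / y) + κ) * w (T ω)) P := hI0.add hI1
  have hinteg := integral_mono_ae (integrable_comp_childStep hcont h0 h1 hT) (hI01.add hI2) hpt
  rw [integral_add' hI01 hI2, integral_add hI0 hI1,
    integral_const_mul, integral_const_mul] at hinteg
  simp only [integral_const, probReal_univ, smul_eq_mul, one_mul] at hinteg
  have hYpos : 0 < Y := by positivity
  have f1 : c * (θ * (Y / y) + κ) * ∫ ω, w (T ω) ∂P ≤ c * (θ * (Y / y) + κ) * (ρ * y) :=
    mul_le_mul_of_nonneg_left hT.integral_lyapunov_le (by positivity)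
  have f2 : 2 * c * ∫ ω, l1norm (T ω) ^ (-ε) ∂P ≤ 2 * c * (C * l1norm t ^ (-ε)) :=
    mul_le_mul_of_nonneg_left hT.integral_rpow_le (by positivity)
  have f3 : c * (θ * (Y / y) + κ) * (ρ * y) = c * (θ * Y * ρ + κ * ρ * y) := by
    field_simp
  have f4 := hT.le_integral
  have f5 := mul_le_mul_of_nonneg_left hbig hc.le
  nlinarith

/-- On a compact annulus 1 - h dominates c times the barrier; beyond it each application of
`gap_step` raises the lower bound by at least cκ(1 - ρ), so finitely many reach zero. Letting κ → 0
then leaves 1 - h ≥ c. -/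
lemma exists_gap {s K : ℝ} (hs : 0 < s) (hK : 0 < K) (hρ : ρ < 1) (hε : 0 < ε)
    (hw1 : ∀ t, l1norm t ^ s ≤ w t) (hwK : ∀ t, w t ≤ K * l1norm t ^ s)
    (hcont : Continuous h) (h0 : ∀ t, 0 ≤ h t) (h1 : ∀ t, h t ≤ 1) (hlt : ∀ t ≠ 0, h t < 1)
    (hstep : ∀ t ≠ 0, ∃ T, ChildStep P h w ρ ε C t T) :
    ∃ l < 1, ∀ t, 1 ≤ l1norm t → h t ≤ l := by
  -- With this θ, w^{-θ} is of order |t|^{-ε/2}, which dominates the error |t|^{-ε} for large |t|.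
  set θ := ε / (2 * s)
  have hθ : 0 < θ := by positivity
  have hsθ : s * θ = ε / 2 := by simp only [θ]; field_simp
  have hne : ∀ t : Fin d → ℝ, 1 ≤ l1norm t → t ≠ 0 := fun t ht h0 => by
    rw [l1norm_eq_zero.2 h0] at ht; linarith
  obtain ⟨R, hR⟩ : ∃ R : ℝ, ∀ r : ℝ, R ≤ r → 0 < r →
      2 * C * r ^ (-(ε / 2)) ≤ θ * (1 - ρ) * K ^ (-θ) := by
    have h2 : Tendsto (fun r : ℝ => 2 * C * r ^ (-(ε / 2))) atTop (𝓝 (2 * C * 0)) :=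
      (tendsto_rpow_neg_atTop (by positivity)).const_mul _
    rw [mul_zero] at h2
    have h3 : 0 < θ * (1 - ρ) * K ^ (-θ) := by
      have : 0 < 1 - ρ := by linarith
      positivity
    obtain ⟨R, hR⟩ := eventually_atTop.1 (h2.eventually (eventually_lt_nhds h3))
    exact ⟨R, fun r hr _ => (hR r hr).le⟩
  have hbig : ∀ t, 1 ≤ l1norm t → R ≤ l1norm t →
      2 * C * l1norm t ^ (-ε) ≤ θ * (1 - ρ) * w t ^ (-θ) := by
    intro t ht htR
    have hpos : 0 < l1norm t := by linarith
    have hwpos : 0 < w t := (Real.rpow_pos_of_pos hpos s).trans_le (hw1 t)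
    calc 2 * C * l1norm t ^ (-ε)
        = 2 * C * l1norm t ^ (-(ε / 2)) * l1norm t ^ (-(ε / 2)) := by
          rw [mul_assoc (2 * C), ← Real.rpow_add hpos]; ring_nf
      _ ≤ θ * (1 - ρ) * K ^ (-θ) * l1norm t ^ (-(ε / 2)) :=
          mul_le_mul_of_nonneg_right (hR _ htR hpos) (by positivity)
      _ = θ * (1 - ρ) * (K * l1norm t ^ s) ^ (-θ) := by
          rw [Real.mul_rpow hK.le (by positivity), ← Real.rpow_mul hpos.le, mul_neg, hsθ]; ring
      _ ≤ θ * (1 - ρ) * w t ^ (-θ) := by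
          have : 0 ≤ 1 - ρ := by linarith
          exact mul_le_mul_of_nonneg_left
            (Real.rpow_le_rpow_of_nonpos hwpos (hwK t) (by linarith)) (by positivity)
  obtain ⟨b, hb0, hb⟩ := (isCompact_l1_annulus (d := d) 1 R).exists_forall_le'
    (f := fun t => 1 - h t) (by fun_prop) (a := 0) fun t ht => by linarith [hlt t (hne t ht.1)]
  -- The barrier is at most 2 on |t| ≥ 1, so c times it is at most b ≤ 1 - h on the annulus.
  set c := b / 2
  have hc : 0 < c := by positivity
  have hwge : ∀ t, 1 ≤ l1norm t → 1 ≤ w t := fun t ht =>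
    (Real.one_le_rpow ht hs.le).trans (hw1 t)
  have hV : ∀ κ > 0, ∀ t, 1 ≤ l1norm t → 1 + w t ^ (-θ) - κ * w t ≤ 2 := by
    intro κ hκ t ht
    have h2 := hwge t ht
    have h3 : w t ^ (-θ) ≤ 1 := Real.rpow_le_one_of_one_le_of_nonpos h2 (by linarith)
    have : 0 ≤ κ * w t := by positivity
    linarith
  have hmain : ∀ κ > 0, ∀ n : ℕ, ∀ t, 1 ≤ l1norm t →
      -(max 0 (2 * c - n * (c * κ * (1 - ρ)))) ≤ 1 - h t - c * (1 + w t ^ (-θ) - κ * w t) := by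
    intro κ hκ n
    have hg : 0 ≤ c * κ * (1 - ρ) := by
      have : 0 ≤ 1 - ρ := by linarith
      positivity
    induction n with
    | zero =>
      intro t ht
      have h2 := hV κ hκ t ht
      have h3 := h1 t
      simp only [Nat.cast_zero, zero_mul, sub_zero, max_eq_right (show (0 : ℝ) ≤ 2 * c by positivity)]
      nlinarith
    | succ n ih =>
      intro t ht
      rcases le_total (l1norm t) R with htR | htR
      · have h2 := hb t ⟨ht, htR⟩
        have h3 := hV κ hκ t ht
        have h4 : b = 2 * c := by simp only [c]; ring
        have h5 := le_max_left 0 (2 * c - ((n + 1 : ℕ) : ℝ) * (c * κ * (1 - ρ)))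
        nlinarith
      · obtain ⟨T, hT⟩ := hstep t (hne t ht)
        have h2 := gap_step hs hθ (by linarith) hκ hc (le_max_left _ _) hw1 hcont h0 h1 ih
          (hne t ht) hT (hbig t ht htR)
        refine le_trans ?_ h2
        have h3 : c * κ * (1 - ρ) ≤ c * κ * (1 - ρ) * w t := le_mul_of_one_le_right hg (hwge t ht)
        push_cast
        have h4 : max 0 (2 * c - n * (c * κ * (1 - ρ))) - c * κ * (1 - ρ)
            ≤ max 0 (2 * c - (n + 1) * (c * κ * (1 - ρ))) := by
          rcases max_cases 0 (2 * c - n * (c * κ * (1 - ρ))) with ⟨h5, -⟩ | ⟨h5, -⟩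
          · rw [h5]; exact le_trans (by linarith) (le_max_left _ _)
          · rw [h5]; exact le_trans (by linarith) (le_max_right _ _)
        linarith
  refine ⟨1 - c, by linarith, fun t ht => ?_⟩
  have hκ : ∀ κ > 0, c * (1 - κ * w t) ≤ 1 - h t := by
    intro κ hκ
    have hg : 0 < c * κ * (1 - ρ) := by
      have : 0 < 1 - ρ := by linarith
      positivity
    obtain ⟨n, hn⟩ := exists_nat_ge (2 * c / (c * κ * (1 - ρ)))
    rw [div_le_iff₀ hg] at hn
    have h2 := hmain κ hκ n t ht
    rw [max_eq_left (by linarith), neg_zero] at h2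
    have h3 : 0 ≤ w t ^ (-θ) := Real.rpow_nonneg (by linarith [hwge t ht]) _
    nlinarith
  have hlim : Tendsto (fun κ : ℝ => c * (1 - κ * w t)) (𝓝[>] 0) (𝓝 (c * (1 - 0 * w t))) :=
    (Continuous.tendsto (by fun_prop) 0).mono_left nhdsWithin_le_nhds
  have := le_of_tendsto hlim (eventually_nhdsWithin_of_forall fun κ (h : 0 < κ) => hκ κ h)
  linarith

end Gap

/-! ### Polynomial decay -/

section Decay

/-- Of two distinct large indices at least one differs from `j`, and its factor is at most `l`. -/
lemma prod_norm_chf_le {Ω : Type*} {d : ℕ} {N : Ω → ℕ} {A : ℕ → Ω → Matrix (Fin d) (Fin d) ℝ}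
    {η : Measure (Fin d → ℝ)} [IsProbabilityMeasure η] {l : ℝ} (hl : ∀ t, 1 ≤ l1norm t → ‖chf η t‖ ≤ l)
    {t : Fin d → ℝ} {ω : Ω} {j : ℕ} (hj : j < N ω) (hzero : ∀ i, N ω ≤ i → A i ω = 0) :
    ∏ i ∈ Finset.range (N ω), ‖chf η ((A i ω)ᵀ *ᵥ t)‖ ≤
      ‖chf η ((A j ω)ᵀ *ᵥ t)‖ * (1 - (twoLarge A t).indicator (fun _ => 1 - l) ω) := by
  classical
  rw [← Finset.mul_prod_erase _ _ (Finset.mem_range.2 hj)]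
  refine mul_le_mul_of_nonneg_left ?_ (norm_nonneg _)
  by_cases hω : ω ∈ twoLarge A t
  · rw [Set.indicator_of_mem hω, sub_sub_cancel]
    have hlt : ∀ i, 1 ≤ l1norm ((A i ω)ᵀ *ᵥ t) → i < N ω := fun i hi => by
      by_contra hcon
      rw [hzero i (not_lt.1 hcon), Matrix.transpose_zero, Matrix.zero_mulVec,
        l1norm_eq_zero.2 rfl] at hi
      linarith
    obtain ⟨k, hkj, hk⟩ : ∃ k, k ≠ j ∧ 1 ≤ l1norm ((A k ω)ᵀ *ᵥ t) := by
      obtain ⟨i, i', hii, hi, hi'⟩ := hω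
      by_cases h : i = j
      · exact ⟨i', fun h' => hii (h.trans h'.symm), hi'⟩
      · exact ⟨i, h, hi⟩
    have hmem : k ∈ (Finset.range (N ω)).erase j :=
      Finset.mem_erase.2 ⟨hkj, Finset.mem_range.2 (hlt k hk)⟩
    rw [← Finset.mul_prod_erase _ _ hmem]
    exact (mul_le_of_le_one_right (norm_nonneg _) (Finset.prod_le_one (fun _ _ => norm_nonneg _)
      fun _ _ => norm_chf_le_one η _)).trans (hl _ hk)
  · rw [Set.indicator_of_notMem hω, sub_zero]
    exact Finset.prod_le_one (fun _ _ => norm_nonneg _) fun _ _ => norm_chf_le_one η _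

variable {Ω : Type*} [MeasurableSpace Ω] {d : ℕ} {P : Measure Ω} [IsProbabilityMeasure P]
  {N : Ω → ℕ} {A : ℕ → Ω → Matrix (Fin d) (Fin d) ℝ}
  {η : Measure (Fin d → ℝ)} [IsProbabilityMeasure η]

/-- Bernoulli's inequality for x^a = (x^ε)^{a/ε}. The coefficient a/ε is what makes the loss in
`decay_step` small for small a. -/
lemma rpow_le_one_add_mul_rpow {x a ε : ℝ} (hx : 0 < x) (ha : 0 < a) (haε : a ≤ ε) :
    max 1 x ^ a ≤ 1 + a / ε * x ^ ε := by
  have hε : 0 < ε := ha.trans_le haε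
  rcases le_total x 1 with h | h
  · rw [max_eq_left h, Real.one_rpow]
    have : 0 ≤ a / ε * x ^ ε := by positivity
    linarith
  · rw [max_eq_right h]
    have h1 : x ^ a = (1 + (x ^ ε - 1)) ^ (a / ε) := by
      rw [add_sub_cancel, ← Real.rpow_mul hx.le, mul_div_cancel₀ _ hε.ne']
    have h2 : 0 ≤ x ^ ε := by positivity
    rw [h1]
    refine (rpow_one_add_le_one_add_mul_self (by linarith) (by positivity)
      ((div_le_one hε).2 haε)).trans ?_
    have : 0 ≤ a / ε := by positivity
    nlinarith

/-- If |T| ≥ 1, the hypothesis applies at T and changing |T| into |t| costs the factor 1 +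
(a/ε)(|t|/|T|)^ε, whose correction has mean at most aC/ε. If |T| < 1, then |t|^a ≤ (|t|/|T|)^ε,
which contributes the additive C. The indicator of two large children supplies -(1 - l)p. No
independence between T and that event is needed. -/
lemma decay_step (hN : Measurable N) (hA : ∀ i, Measurable (A i))
    (hb : BranchingCondition P N A) (hfix : smoothingTransform P N A η = η)
    {w : (Fin d → ℝ) → ℝ} {ρ ε C l p a R M : ℝ}
    (hl : ∀ t, 1 ≤ l1norm t → ‖chf η t‖ ≤ l) (hl1 : l ≤ 1) (hl0 : 0 ≤ l)
    (ha : 0 < a) (haε : a ≤ ε) (hR : 0 < R) (hM : 0 ≤ M)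
    (hind : ∀ t, 1 ≤ l1norm t → ‖chf η t‖ * min (l1norm t) R ^ a ≤ M)
    {t : Fin d → ℝ} (ht : 1 ≤ l1norm t) (hp : ENNReal.ofReal p ≤ P (twoLarge A t))
    {j : Ω → ℕ} (hj : ∀ᵐ ω ∂P, j ω < N ω)
    (hT : ChildStep P (fun t => ‖chf η t‖) w ρ ε C t fun ω => (A (j ω) ω)ᵀ *ᵥ t) :
    ‖chf η t‖ * min (l1norm t) R ^ a ≤ (1 - (1 - l) * p + a / ε * C) * M + C := by
  have hε : 0 < ε := ha.trans_le haε
  set T : Ω → Fin d → ℝ := fun ω => (A (j ω) ω)ᵀ *ᵥ t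
  have htpos : 0 < l1norm t := by linarith
  set τ := l1norm t ^ ε
  have hτ : 0 < τ := by positivity
  set I : Ω → ℝ := (twoLarge A t).indicator fun _ => 1 - l
  have hImeas : MeasurableSet (twoLarge A t) := measurableSet_twoLarge hA t
  have hI0 : ∀ ω, 0 ≤ I ω := fun ω => Set.indicator_nonneg (fun _ _ => by linarith) ω
  have hI1 : ∀ ω, I ω ≤ 1 := fun ω =>
    (Set.indicator_le_self' (fun _ _ => by linarith) ω).trans (by linarith)
  have hIint : Integrable I P := (integrable_const _).indicator hImeas
  have hpt : ∀ᵐ ω ∂P, (∏ i ∈ Finset.range (N ω), ‖chf η ((A i ω)ᵀ *ᵥ t)‖) * min (l1norm t) R ^ a ≤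
      M * (1 - I ω) + (M * (a / ε) + 1) * τ * l1norm (T ω) ^ (-ε) := by
    filter_upwards [hj, hT.ne_zero, hb.eq_zero] with ω hjω hne hz
    have hTpos : 0 < l1norm (T ω) := l1norm_pos hne
    have h1 := prod_norm_chf_le hl (t := t) hjω hz
    have hm0 : 0 < min (l1norm t) R := lt_min htpos hR
    have hI' : 0 ≤ 1 - I ω := by linarith [hI1 ω]
    have hx : τ * l1norm (T ω) ^ (-ε) = (l1norm t / l1norm (T ω)) ^ ε := by
      rw [Real.div_rpow htpos.le hTpos.le, Real.rpow_neg hTpos.le, div_eq_mul_inv]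
    have hxpos : 0 < τ * l1norm (T ω) ^ (-ε) := by positivity
    refine (mul_le_mul_of_nonneg_right h1 (by positivity)).trans ?_
    change ‖chf η (T ω)‖ * (1 - I ω) * min (l1norm t) R ^ a ≤ _
    rcases le_or_gt 1 (l1norm (T ω)) with hc | hc
    · have hm1 : 0 < min (l1norm (T ω)) R := lt_min hTpos hR
      have h2 : min (l1norm t) R ^ a ≤
          min (l1norm (T ω)) R ^ a * max 1 (l1norm t / l1norm (T ω)) ^ a := by
        rw [← Real.mul_rpow hm1.le (by positivity)]
        refine Real.rpow_le_rpow hm0.le ?_ ha.le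
        rcases le_total (l1norm (T ω)) R with h3 | h3
        · rw [min_eq_left h3]
          calc min (l1norm t) R ≤ l1norm t := min_le_left _ _
            _ = l1norm (T ω) * (l1norm t / l1norm (T ω)) := by field_simp
            _ ≤ _ := mul_le_mul_of_nonneg_left (le_max_right _ _) hTpos.le
        · rw [min_eq_right h3]
          exact (min_le_right _ _).trans (le_mul_of_one_le_right hR.le (le_max_left _ _))
      have h3 := rpow_le_one_add_mul_rpow (div_pos htpos hTpos) ha haε
      rw [← hx] at h3
      have h4 : ‖chf η (T ω)‖ * min (l1norm t) R ^ a ≤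
          M * (1 + a / ε * (τ * l1norm (T ω) ^ (-ε))) := by
        calc _ ≤ ‖chf η (T ω)‖ * (min (l1norm (T ω)) R ^ a *
              max 1 (l1norm t / l1norm (T ω)) ^ a) := mul_le_mul_of_nonneg_left h2 (norm_nonneg _)
          _ = (‖chf η (T ω)‖ * min (l1norm (T ω)) R ^ a) *
              max 1 (l1norm t / l1norm (T ω)) ^ a := by ring
          _ ≤ M * (1 + a / ε * (τ * l1norm (T ω) ^ (-ε))) :=
              mul_le_mul (hind _ hc) h3 (by positivity) hM
      have h5 : 0 ≤ M * (a / ε) * (τ * l1norm (T ω) ^ (-ε)) := by positivity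
      calc ‖chf η (T ω)‖ * (1 - I ω) * min (l1norm t) R ^ a
          = (1 - I ω) * (‖chf η (T ω)‖ * min (l1norm t) R ^ a) := by ring
        _ ≤ (1 - I ω) * (M * (1 + a / ε * (τ * l1norm (T ω) ^ (-ε)))) :=
            mul_le_mul_of_nonneg_left h4 hI'
        _ = M * (1 - I ω) + (1 - I ω) * (M * (a / ε) * (τ * l1norm (T ω) ^ (-ε))) := by ring
        _ ≤ M * (1 - I ω) + M * (a / ε) * (τ * l1norm (T ω) ^ (-ε)) := by
            have := mul_le_of_le_one_left h5 (show 1 - I ω ≤ 1 by linarith [hI0 ω])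
            linarith
        _ ≤ _ := by nlinarith
    · have h2 : min (l1norm t) R ^ a ≤ τ * l1norm (T ω) ^ (-ε) := by
        calc min (l1norm t) R ^ a ≤ l1norm t ^ a :=
              Real.rpow_le_rpow hm0.le (min_le_left _ _) ha.le
          _ ≤ τ := Real.rpow_le_rpow_of_exponent_le ht haε
          _ ≤ _ := le_mul_of_one_le_right hτ.le
              (Real.one_le_rpow_of_pos_of_le_one_of_nonpos hTpos hc.le (by linarith))
      have h3 : ‖chf η (T ω)‖ * (1 - I ω) ≤ 1 :=
        mul_le_one₀ (norm_chf_le_one η _) hI' (by linarith [hI0 ω])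
      have h4 : 0 ≤ M * (1 - I ω) + M * (a / ε) * (τ * l1norm (T ω) ^ (-ε)) := by positivity
      calc ‖chf η (T ω)‖ * (1 - I ω) * min (l1norm t) R ^ a ≤ 1 * min (l1norm t) R ^ a :=
            mul_le_mul_of_nonneg_right h3 (by positivity)
        _ ≤ τ * l1norm (T ω) ^ (-ε) := by linarith
        _ ≤ _ := by nlinarith
  have hJ1 : Integrable (fun ω => M * (1 - I ω)) P := ((integrable_const _).sub hIint).const_mul _
  have hJ2 := hT.integrable_rpow.const_mul ((M * (a / ε) + 1) * τ)
  have hinteg := integral_mono_of_nonneg (ae_of_all _ fun ω => by positivity) (hJ1.add hJ2) hpt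
  rw [integral_mul_const, integral_add' hJ1 hJ2, integral_const_mul, integral_const_mul,
    integral_sub (integrable_const _) hIint, integral_indicator hImeas] at hinteg
  simp only [integral_const, probReal_univ, smul_eq_mul, mul_one, measureReal_restrict_apply_univ]
    at hinteg
  have hp' : p ≤ P.real (twoLarge A t) := by
    rw [Measure.real]
    exact (ENNReal.ofReal_le_iff_le_toReal (measure_ne_top _ _)).1 hp
  have h1 := mul_le_mul_of_nonneg_right (norm_chf_le hN hA hfix t)
    (show 0 ≤ min (l1norm t) R ^ a by positivity)
  have h2 : (M * (a / ε) + 1) * τ * ∫ ω, l1norm (T ω) ^ (-ε) ∂P ≤ (M * (a / ε) + 1) * C := by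
    have h3 := mul_le_mul_of_nonneg_left hT.integral_rpow_le
      (show 0 ≤ (M * (a / ε) + 1) * τ by positivity)
    refine h3.trans_eq ?_
    rw [Real.rpow_neg htpos.le]
    change _ * τ * (C * τ⁻¹) = _
    field_simp
  have h3 : P.real (twoLarge A t) * (1 - l) ≥ p * (1 - l) :=
    mul_le_mul_of_nonneg_right hp' (by linarith)
  nlinarith

lemma exists_decay (hN : Measurable N) (hA : ∀ i, Measurable (A i))
    (hb : BranchingCondition P N A) (hα : AlphaCondition P N A) (hact : ActivityCondition P A)
    (hfix : smoothingTransform P N A η = η)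
    (hnd : ∀ t : Fin d → ℝ, t ≠ 0 → ∀ c : ℝ, ¬ ∀ᵐ x ∂η, t ⬝ᵥ x = c) :
    ∃ a C : ℝ, 0 < a ∧ 0 < C ∧ ∀ t ≠ 0, ‖chf η t‖ ≤ C * l1norm t ^ (-a) := by
  obtain ⟨s, ρ, K, w, hs, hρ0, hρ1, hwm, hw1, hwK, hw⟩ := exists_lyapunov hN hA hb hα
  have hw0 : ∀ t, 0 ≤ w t := fun t => (Real.rpow_nonneg (l1norm_nonneg t) _).trans (hw1 t)
  obtain ⟨ε, C, hε, hC, hchild⟩ := exists_childStep hN hA hb hact hfix hρ0 hwm hw0 hw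
  have hcont : Continuous fun t => ‖chf η t‖ := (continuous_chf η).norm
  have hstep : ∀ t ≠ 0, ∃ T, ChildStep P (fun t => ‖chf η t‖) w ρ ε C t T := fun t ht => by
    obtain ⟨j, -, hT⟩ := hchild t ht
    exact ⟨_, hT⟩
  have hlt : ∀ t ≠ 0, ‖chf η t‖ < 1 := by
    intro t ht
    refine (norm_chf_le_one η t).lt_of_ne fun h1 => ?_
    obtain ⟨f, hf, hlim⟩ := exists_seq_of_eq_one hs hρ0 hρ1 hw1 hcont (fun _ => norm_nonneg _)
      (norm_chf_le_one η) hstep ht h1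
    obtain ⟨u, hu, c, hc⟩ := exists_dotProduct_ae_const hf hlim
    exact hnd u hu c hc
  obtain ⟨l', hl'1, hl'⟩ := exists_gap hs (lt_max_of_lt_right one_pos : 0 < max K 1) hρ1 hε hw1
    (fun t => (hwK t).trans (mul_le_mul_of_nonneg_right (le_max_left _ _)
      (Real.rpow_nonneg (l1norm_nonneg t) _))) hcont (fun _ => norm_nonneg _)
    (norm_chf_le_one η) hlt hstep
  set l := max l' 0
  have hl1 : l < 1 := max_lt hl'1 one_pos
  have hl0 : 0 ≤ l := le_max_right _ _
  have hl : ∀ t, 1 ≤ l1norm t → ‖chf η t‖ ≤ l := fun t ht => (hl' t ht).trans (le_max_left _ _)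
  obtain ⟨p, R₀, hp, hR₀, htwo⟩ := exists_le_measure_twoLarge hact
  have hl1' : 0 < 1 - l := by linarith
  -- Half of the gain (1 - l)p is kept; a is chosen so that its loss aC/ε uses at most the other
  -- half.
  set δ := (1 - l) * p / 2
  have hδ : 0 < δ := by positivity
  set a := min ε (δ * ε / C)
  have ha : 0 < a := by positivity
  have haC : a / ε * C ≤ δ := by
    calc a / ε * C ≤ (δ * ε / C) / ε * C := by gcongr; exact min_le_right _ _
      _ = δ := by field_simp
  -- C/δ is the fixed point of M ↦ (1 - δ)M + C, and R₀^a covers |t| ≤ R₀, where `htwo` is not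
  -- available.
  set B := max (R₀ ^ a) (C / δ)
  have hBC : C ≤ δ * B := by
    calc C = δ * (C / δ) := by field_simp
      _ ≤ δ * B := mul_le_mul_of_nonneg_left (le_max_right _ _) hδ.le
  have hB0 : 0 < B := lt_max_of_lt_right (by positivity)
  -- Truncation at R makes the initial bound R^a finite. It is forgotten geometrically, so R = |t|
  -- may be taken after n → ∞.
  have hiter : ∀ R : ℝ, 0 < R → ∀ n : ℕ, ∀ t, 1 ≤ l1norm t →
      ‖chf η t‖ * min (l1norm t) R ^ a ≤ B + (max (1 - δ) 0) ^ n * R ^ a := by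
    intro R hR n
    induction n with
    | zero =>
      intro t ht
      have hm : min (l1norm t) R ^ a ≤ R ^ a :=
        Real.rpow_le_rpow (le_min (by linarith) hR.le) (min_le_right _ _) ha.le
      have : 0 ≤ min (l1norm t) R ^ a := Real.rpow_nonneg (le_min (by linarith) hR.le) _
      have := mul_le_mul (norm_chf_le_one η t) hm this zero_le_one
      simp only [pow_zero, one_mul] at this ⊢
      linarith
    | succ n ih =>
      intro t ht
      set X := (max (1 - δ) 0) ^ n * R ^ a
      have hX : 0 ≤ X := by positivity
      have hnn : 0 ≤ (max (1 - δ) 0) ^ (n + 1) * R ^ a := by positivity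
      rcases le_total (l1norm t) R₀ with h1 | h1
      · have h2 : min (l1norm t) R ^ a ≤ R₀ ^ a :=
          Real.rpow_le_rpow (le_min (by linarith) hR.le) ((min_le_left _ _).trans h1) ha.le
        have h3 : 0 ≤ min (l1norm t) R ^ a := Real.rpow_nonneg (le_min (by linarith) hR.le) _
        have h4 := mul_le_mul (norm_chf_le_one η t) h2 h3 zero_le_one
        have h5 : R₀ ^ a ≤ B := le_max_left _ _
        linarith
      · have ht0 : t ≠ 0 := fun h0 => by rw [l1norm_eq_zero.2 h0] at ht; linarith
        obtain ⟨j, hj, hT⟩ := hchild t ht0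
        have h2 := decay_step hN hA hb hfix hl hl1.le hl0 ha (min_le_left _ _) hR
          (add_nonneg hB0.le hX) ih ht (htwo t h1) hj hT
        have h3 : (1 - (1 - l) * p + a / ε * C) * (B + X) ≤ (1 - δ) * (B + X) := by
          refine mul_le_mul_of_nonneg_right ?_ (add_nonneg hB0.le hX)
          have : (1 - l) * p = 2 * δ := by simp only [δ]; ring
          linarith
        have h4 : (1 - δ) * X ≤ max (1 - δ) 0 * X := mul_le_mul_of_nonneg_right (le_max_left _ _) hX
        have h5 : (max (1 - δ) 0) ^ (n + 1) * R ^ a = max (1 - δ) 0 * X := by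
          simp only [X]; ring
        rw [h5]
        nlinarith
  refine ⟨a, max B 1, ha, lt_max_of_lt_right one_pos, fun t ht => ?_⟩
  have htpos := l1norm_pos ht
  rcases le_total 1 (l1norm t) with h1 | h1
  · have hlim : Tendsto (fun n : ℕ => B + (max (1 - δ) 0) ^ n * l1norm t ^ a) atTop
        (𝓝 (B + 0 * l1norm t ^ a)) :=
      ((tendsto_pow_atTop_nhds_zero_of_lt_one (le_max_right _ _)
        (max_lt (by linarith) one_pos)).mul_const _).const_add _
    have h2 := ge_of_tendsto' hlim fun n => hiter (l1norm t) htpos n t h1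
    rw [min_self, zero_mul, add_zero] at h2
    rw [Real.rpow_neg htpos.le, ← div_eq_mul_inv, le_div_iff₀ (by positivity)]
    exact h2.trans (le_max_left _ _)
  · refine (norm_chf_le_one η t).trans ?_
    have h2 := Real.one_le_rpow_of_pos_of_le_one_of_nonpos htpos h1 (z := -a) (by linarith)
    calc (1 : ℝ) = 1 * 1 := by ring
      _ ≤ max B 1 * l1norm t ^ (-a) := mul_le_mul (le_max_right _ _) h2 zero_le_one (by positivity)

end Decay

/-! ### Integrable characteristic functions -/

section FourierInversion

open FourierTransform SchwartzMap

variable {E : Type*} [NormedAddCommGroup E] [InnerProductSpace ℝ E] [FiniteDimensional ℝ E]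
  [MeasurableSpace E] [BorelSpace E] (ν : Measure E) [IsFiniteMeasure ν]

lemma fourierIntegral_one_eq_charFun {E : Type*} [NormedAddCommGroup E] [InnerProductSpace ℝ E]
    [MeasurableSpace E] (ν : Measure E) (ξ : E) :
    VectorFourier.fourierIntegral Real.fourierChar ν (innerₗ E) 1 ξ =
      charFun ν (-(2 * Real.pi) • ξ) := by
  rw [charFun_eq_fourierIntegral', smul_smul, neg_mul_neg,
    inv_mul_cancel₀ Real.two_pi_pos.ne', one_smul]

/-- Fubini for the Fourier kernel, applied to the constant 1 against ν and to the inverse transform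
of `f` against Lebesgue measure. -/
lemma integral_schwartz_eq (f : 𝓢(E, ℂ)) :
    ∫ x, f x ∂ν = ∫ ξ, charFun ν (-(2 * Real.pi) • ξ) * (𝓕⁻ f) ξ := by
  have h1 := VectorFourier.integral_fourierIntegral_smul_eq_flip (μ := ν) (ν := volume)
    (f := fun _ : E => (1 : ℂ)) (g := fun ξ => (𝓕⁻ f) ξ) (L := innerₗ E)
    Real.continuous_fourierChar (by simpa using continuous_inner) (integrable_const _)
    (𝓕⁻ f).integrable
  have h2 : ∀ x, VectorFourier.fourierIntegral Real.fourierChar volume (innerₗ E).flip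
      (fun ξ => (𝓕⁻ f) ξ) x = f x := by
    intro x
    rw [flip_innerₗ]
    have h3 : 𝓕 (𝓕⁻ f) = f := FourierTransform.fourier_fourierInv_eq f
    have h4 := congrArg (fun g : 𝓢(E, ℂ) => g x) h3
    simp only [SchwartzMap.fourier_coe] at h4
    rw [← h4]
    rfl
  simp only [h2, smul_eq_mul, one_mul] at h1
  rw [← h1]
  exact integral_congr_ae (ae_of_all _ fun ξ => by
    simp only [← fourierIntegral_one_eq_charFun ν ξ]; rfl)

lemma norm_integral_schwartz_le (hν : Integrable (charFun ν)) (f : 𝓢(E, ℂ)) :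
    ‖∫ x, f x ∂ν‖ ≤ (∫ ξ, ‖charFun ν (-(2 * Real.pi) • ξ)‖) * ∫ x, ‖f x‖ := by
  have hne : -(2 * Real.pi) ≠ 0 := neg_ne_zero.2 Real.two_pi_pos.ne'
  have hinteg : Integrable fun ξ : E => ‖charFun ν (-(2 * Real.pi) • ξ)‖ :=
    (hν.comp_smul hne).norm
  rw [integral_schwartz_eq, ← integral_mul_const]
  refine norm_integral_le_of_norm_le (hinteg.mul_const _) (ae_of_all _ fun ξ => ?_)
  rw [norm_mul]
  refine mul_le_mul_of_nonneg_left ?_ (norm_nonneg _)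
  rw [SchwartzMap.fourierInv_coe, Real.fourierInv_eq_fourier_neg]
  exact VectorFourier.norm_fourierIntegral_le_integral_norm _ _ _ _ _

/-- Test ν against a smooth bump equal to 1 on K and supported in U. -/
lemma measure_compact_le (hν : Integrable (charFun ν)) {K U : Set E} (hK : IsCompact K)
    (hU : IsOpen U) (hKU : K ⊆ U) :
    ν K ≤ ENNReal.ofReal (∫ ξ, ‖charFun ν (-(2 * Real.pi) • ξ)‖) * volume U := by
  set B := ∫ ξ, ‖charFun ν (-(2 * Real.pi) • ξ)‖
  have hB : 0 ≤ B := integral_nonneg fun _ => norm_nonneg _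
  -- The thickening bounds the support, so that the bump is a Schwartz function.
  set W := U ∩ Metric.thickening 1 K
  have hWo : IsOpen W := hU.inter Metric.isOpen_thickening
  have hKW : K ⊆ W := Set.subset_inter hKU (Metric.self_subset_thickening one_pos K)
  obtain ⟨g, hg1, hgr, hgs, hgK⟩ :=
    exists_contMDiff_support_eq_eq_one_iff (modelWithCornersSelf ℝ E) hWo hK.isClosed hKW
  have hgd : ContDiff ℝ (⊤ : ℕ∞) g := hg1.contDiff
  have hWb : Bornology.IsBounded W := hK.isBounded.thickening.subset Set.inter_subset_right
  have hgc : HasCompactSupport g := by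
    refine HasCompactSupport.of_support_subset_isCompact hWb.isCompact_closure ?_
    rw [hgs]
    exact subset_closure
  have hg0 : ∀ x, 0 ≤ g x := fun x => (hgr ⟨x, rfl⟩).1
  have hg1 : ∀ x, g x ≤ 1 := fun x => (hgr ⟨x, rfl⟩).2
  have hfc : HasCompactSupport fun x => (g x : ℂ) := hgc.comp_left Complex.ofReal_zero
  set f : 𝓢(E, ℂ) := hfc.toSchwartzMap (Complex.ofRealCLM.contDiff.comp hgd)
  have hf : ∀ x, f x = (g x : ℂ) := fun x => rfl
  have hgint : ∀ (m : Measure E) [IsFiniteMeasureOnCompacts m], Integrable g m := fun m _ =>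
    hgd.continuous.integrable_of_hasCompactSupport hgc
  have hle := norm_integral_schwartz_le ν hν f
  have hnorm : ∀ x, ‖f x‖ = g x := fun x => by
    rw [hf, Complex.norm_real, Real.norm_of_nonneg (hg0 x)]
  simp only [hnorm] at hle
  simp only [hf] at hle
  rw [integral_complex_ofReal, Complex.norm_real,
    Real.norm_of_nonneg (integral_nonneg hg0)] at hle
  calc ν K = ∫⁻ x, K.indicator 1 x ∂ν := (lintegral_indicator_one hK.measurableSet).symm
    _ ≤ ∫⁻ x, ENNReal.ofReal (g x) ∂ν := by
      refine lintegral_mono fun x => ?_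
      by_cases hx : x ∈ K
      · simp [hx, (hgK x).1 hx]
      · simp [hx]
    _ = ENNReal.ofReal (∫ x, g x ∂ν) :=
      (ofReal_integral_eq_lintegral_ofReal (hgint ν) (ae_of_all _ hg0)).symm
    _ ≤ ENNReal.ofReal (B * ∫ x, g x) := ENNReal.ofReal_le_ofReal hle
    _ = ENNReal.ofReal B * ∫⁻ x, ENNReal.ofReal (g x) := by
      rw [ENNReal.ofReal_mul hB,
        ofReal_integral_eq_lintegral_ofReal (hgint volume) (ae_of_all _ hg0)]
    _ ≤ ENNReal.ofReal B * volume U := by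
      gcongr
      rw [← lintegral_indicator_one hU.measurableSet]
      refine lintegral_mono fun x => ?_
      by_cases hx : x ∈ U
      · simpa [hx] using hg1 x
      · have : g x = 0 := by
          by_contra h0
          have : x ∈ Function.support g := h0
          rw [hgs] at this
          exact hx this.1
        simp [this]

lemma absolutelyContinuous_of_integrable_charFun (hν : Integrable (charFun ν)) : ν ≪ volume := by
  refine Measure.AbsolutelyContinuous.mk fun S hS h0 => ?_
  rw [hS.measure_eq_iSup_isCompact]
  refine le_antisymm (iSup₂_le fun K hKS => iSup_le fun hK => ?_) zero_le
  have hK0 : volume K = 0 := measure_mono_null hKS h0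
  set B := ENNReal.ofReal (∫ ξ, ‖charFun ν (-(2 * Real.pi) • ξ)‖)
  have hlim : Tendsto (fun δ : ℝ≥0∞ => B * δ) (𝓝[>] 0) (𝓝 (B * 0)) :=
    (ENNReal.Tendsto.const_mul tendsto_id (Or.inr ENNReal.ofReal_ne_top)).mono_left
      nhdsWithin_le_nhds
  rw [mul_zero] at hlim
  refine ge_of_tendsto hlim (eventually_nhdsWithin_of_forall fun δ (hδ : 0 < δ) => ?_)
  obtain ⟨U, hKU, hU, hlt⟩ := K.exists_isOpen_lt_of_lt δ (by rwa [hK0])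
  exact (measure_compact_le ν hν hK hU hKU).trans (mul_le_mul_right hlt.le _)

end FourierInversion

/-! ### Absolute continuity of convolutions -/

section Slices

variable {E : Type*} [NormedAddCommGroup E] [InnerProductSpace ℝ E] [FiniteDimensional ℝ E]
  [MeasurableSpace E] [BorelSpace E]

lemma ae_slice_null (V : Submodule ℝ E) {S : Set E} (hS : MeasurableSet S)
    (h0 : (Measure.addHaar : Measure E) S = 0) :
    ∀ᵐ y : Vᗮ ∂Measure.addHaar, (Measure.addHaar : Measure V) {v | (y : E) + v ∈ S} = 0 := by
  set L : (Vᗮ × V) ≃L[ℝ] E :=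
    (Submodule.prodEquivOfIsCompl Vᗮ V V.isCompl_orthogonal.symm).toContinuousLinearEquiv
  have hL : ∀ p : Vᗮ × V, L p = (p.1 : E) + p.2 := fun p => rfl
  set m : Measure (Vᗮ × V) := (Measure.addHaar : Measure Vᗮ).prod (Measure.addHaar : Measure V)
  have hm : (m.map L) S = 0 := by
    have : (m.map L).IsAddHaarMeasure := L.isAddHaarMeasure_map m
    exact Measure.absolutelyContinuous_isAddHaarMeasure (m.map L) Measure.addHaar h0
  rw [Measure.map_apply L.continuous.measurable hS,
    Measure.measure_prod_null (L.continuous.measurable hS)] at hm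
  exact hm

/-- Fubini along V: for almost every projection of y to Vᗮ the slice of a null set is null in V, and
the V-component of y only translates that slice. -/
lemma conv_absolutelyContinuous_of_projection (V : Submodule ℝ E) {ν₁ : Measure V} [SFinite ν₁]
    (h₁ : ν₁ ≪ Measure.addHaar) {ν₂ : Measure E} [SFinite ν₂]
    (h₂ : ν₂.map Vᗮ.orthogonalProjectionOnto ≪ Measure.addHaar) :
    (ν₁.map V.subtypeL) ∗ ν₂ ≪ Measure.addHaar := by
  refine Measure.AbsolutelyContinuous.mk fun S hS h0 => ?_
  rw [Measure.conv_comm, ← lintegral_indicator_one hS,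
    Measure.lintegral_conv (measurable_one.indicator hS)]
  have hae := ae_of_ae_map (by fun_prop) (h₂.ae_le (ae_slice_null V hS h0))
  refine (lintegral_congr_ae (g := 0) ?_).trans (by simp)
  filter_upwards [hae] with y hy
  rw [lintegral_map (by exact (measurable_one.indicator hS).comp (measurable_const_add y))
    V.subtypeL.continuous.measurable]
  have hmeas : MeasurableSet {v : V | y + (v : E) ∈ S} :=
    ((measurable_const_add y).comp V.subtypeL.continuous.measurable) hS
  have h3 : ∀ v : V, S.indicator (1 : E → ℝ≥0∞) (y + V.subtypeL v) =
      {v : V | y + (v : E) ∈ S}.indicator 1 v := fun v => rfl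
  simp only [h3]
  rw [lintegral_indicator_one hmeas]
  refine h₁ ?_
  have hy2 : ∀ v : V, y + (v : E) =
      (Vᗮ.orthogonalProjectionOnto y : E) + ((V.orthogonalProjectionOnto y + v : V) : E) := by
    intro v
    have := V.starProjection_add_starProjection_orthogonal y
    simp only [Submodule.starProjection_apply] at this
    rw [Submodule.coe_add, ← add_assoc]
    nth_rewrite 1 [← this]
    abel
  have h4 : {v : V | y + (v : E) ∈ S} = (fun v => V.orthogonalProjectionOnto y + v) ⁻¹'
      {v : V | (Vᗮ.orthogonalProjectionOnto y : E) + v ∈ S} := by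
    ext v
    rw [Set.mem_preimage]
    change y + (v : E) ∈ S ↔ (Vᗮ.orthogonalProjectionOnto y : E) + _ ∈ S
    rw [hy2 v]
  rw [h4, measure_preimage_add]
  exact hy

end Slices

/-! ### Spanning families -/

section Spanning

variable {d : ℕ} {E : Type*} [NormedAddCommGroup E] [InnerProductSpace ℝ E]

/-- The ranges of the maps in `l` span `E`. -/
def Spans (l : List ((Fin d → ℝ) →L[ℝ] E)) : Prop :=
  ∀ ξ : E, (∀ C ∈ l, ∀ x, inner ℝ (C x) ξ = 0) → ξ = 0

lemma Spans.mono {l l' : List ((Fin d → ℝ) →L[ℝ] E)} (h : Spans l)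
    (hl : ∀ C ∈ l, C ≠ 0 → C ∈ l') : Spans l' := fun ξ hξ => h ξ fun C hC x => by
  by_cases h0 : C = 0
  · simp [h0]
  · exact hξ C (hl C hC h0) x

lemma spans_of_surjective {l : List ((Fin d → ℝ) →L[ℝ] E)} {C : (Fin d → ℝ) →L[ℝ] E} (hC : C ∈ l)
    (hs : Function.Surjective C) : Spans l := fun ξ hξ => by
  obtain ⟨x, rfl⟩ := hs ξ
  exact inner_self_eq_zero.1 (hξ C hC x)

/-- The vector representing `x ↦ ⟨C x, ξ⟩`. -/
def dualVec (C : (Fin d → ℝ) →L[ℝ] E) (ξ : E) : Fin d → ℝ := fun k => inner ℝ (C (Pi.single k 1)) ξ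

lemma inner_eq_dualVec (C : (Fin d → ℝ) →L[ℝ] E) (ξ : E) (x : Fin d → ℝ) :
    inner ℝ (C x) ξ = dualVec C ξ ⬝ᵥ x := by
  have hx : x = ∑ k, x k • (Pi.single k (1 : ℝ) : Fin d → ℝ) := by
    ext j
    simp [Finset.sum_apply, Pi.single_apply]
  conv_lhs => rw [hx]
  simp only [map_sum, map_smul, sum_inner, inner_smul_left, dualVec, dotProduct, conj_trivial]
  exact Finset.sum_congr rfl fun k _ => mul_comm _ _

lemma dualVec_comp_matCLM (C : (Fin d → ℝ) →L[ℝ] E) (a : Matrix (Fin d) (Fin d) ℝ) (ξ : E) :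
    dualVec (C.comp (matCLM a)) ξ = aᵀ *ᵥ dualVec C ξ := by
  ext k
  have h1 : dualVec (C.comp (matCLM a)) ξ k = dualVec C ξ ⬝ᵥ (a *ᵥ Pi.single k 1) := by
    rw [← inner_eq_dualVec]; rfl
  rw [h1, Matrix.mulVec_single_one, dotProduct_comm]
  rfl

lemma dualVec_smul (C : (Fin d → ℝ) →L[ℝ] E) (c : ℝ) (ξ : E) :
    dualVec C (c • ξ) = c • dualVec C ξ := by
  ext k; simp [dualVec, inner_smul_right]

lemma dualVec_ne_zero {C : (Fin d → ℝ) →L[ℝ] E} (hC : Function.Surjective C) {ξ : E} (hξ : ξ ≠ 0) :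
    dualVec C ξ ≠ 0 := fun h0 => by
  obtain ⟨x, rfl⟩ := hC ξ
  refine hξ (inner_self_eq_zero (𝕜 := ℝ).1 ?_)
  rw [inner_eq_dualVec, h0, zero_dotProduct]

/-- Surjectivity of D makes the adjoint ξ ↦ `dualVec D ξ` injective, hence bounded below in finite
dimension. -/
lemma exists_norm_chf_dualVec_le [FiniteDimensional ℝ E] {η : Measure (Fin d → ℝ)}
    [IsProbabilityMeasure η] {a C : ℝ} (ha : 0 < a) (hC : 0 < C)
    (hdec : ∀ t ≠ 0, ‖chf η t‖ ≤ C * l1norm t ^ (-a)) {D : (Fin d → ℝ) →L[ℝ] E}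
    (hD : Function.Surjective D) :
    ∃ B : ℝ, 0 ≤ B ∧ ∀ ξ, ‖chf η (dualVec D ξ)‖ ≤ B * (1 + ‖ξ‖) ^ (-a) := by
  set L : E →ₗ[ℝ] (Fin d → ℝ) :=
    { toFun := dualVec D
      map_add' := fun x y => by ext k; simp [dualVec, inner_add_right]
      map_smul' := fun c x => dualVec_smul D c x }
  have hker : LinearMap.ker L = ⊥ := by
    refine LinearMap.ker_eq_bot'.2 fun ξ h => ?_
    by_contra h0
    exact dualVec_ne_zero hD h0 h
  obtain ⟨κ, hκ, hanti⟩ := L.exists_antilipschitzWith hker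
  have hlow : ∀ ξ : E, ‖ξ‖ ≤ κ * l1norm (dualVec D ξ) := by
    intro ξ
    have h1 := hanti.le_mul_dist ξ 0
    rw [map_zero, dist_zero_right, dist_zero_right] at h1
    refine h1.trans (mul_le_mul_of_nonneg_left ?_ κ.2)
    refine (pi_norm_le_iff_of_nonneg (l1norm_nonneg _)).2 fun i => ?_
    exact Finset.single_le_sum (f := fun i => |dualVec D ξ i|) (fun _ _ => abs_nonneg _)
      (Finset.mem_univ i)
  have hκ' : (0 : ℝ) < κ := hκ
  refine ⟨2 ^ a + C * (2 * κ) ^ a, by positivity, fun ξ => ?_⟩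
  have hpos : 0 < 1 + ‖ξ‖ := by positivity
  have hP : 0 < (1 + ‖ξ‖) ^ (-a) := by positivity
  rcases le_total ‖ξ‖ 1 with h | h
  · refine (norm_chf_le_one η _).trans ?_
    have h2 : (2 : ℝ) ^ (-a) ≤ (1 + ‖ξ‖) ^ (-a) :=
      Real.rpow_le_rpow_of_nonpos hpos (by linarith) (by linarith)
    have h3 : (1 : ℝ) = 2 ^ a * 2 ^ (-a) := by
      rw [← Real.rpow_add two_pos, add_neg_cancel, Real.rpow_zero]
    have h4 : (0 : ℝ) ≤ C * (2 * κ) ^ a * (1 + ‖ξ‖) ^ (-a) := by positivity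
    have h5 : (0 : ℝ) < 2 ^ a := by positivity
    nlinarith
  · have hξ : ξ ≠ 0 := fun h0 => by rw [h0, norm_zero] at h; linarith
    have hne := dualVec_ne_zero hD hξ
    have hl := l1norm_pos hne
    refine (hdec _ hne).trans ?_
    have h2 : l1norm (dualVec D ξ) ^ (-a) ≤ ((1 + ‖ξ‖) / (2 * κ)) ^ (-a) := by
      refine Real.rpow_le_rpow_of_nonpos (by positivity) ?_ (by linarith)
      rw [div_le_iff₀ (by positivity)]
      nlinarith [hlow ξ]
    have h3 : ((1 + ‖ξ‖) / (2 * κ)) ^ (-a) = (2 * κ) ^ a * (1 + ‖ξ‖) ^ (-a) := by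
      rw [Real.div_rpow hpos.le (by positivity), Real.rpow_neg (x := 2 * (κ : ℝ)) (by positivity)]
      field_simp
    rw [h3] at h2
    have h4 : (0 : ℝ) ≤ 2 ^ a * (1 + ‖ξ‖) ^ (-a) := by positivity
    nlinarith [mul_le_mul_of_nonneg_left h2 hC.le]

end Spanning

/-! ### Sums of many surjective images -/

section FullRank

variable {d : ℕ} {E : Type*} [NormedAddCommGroup E] [InnerProductSpace ℝ E] [FiniteDimensional ℝ E]
  [MeasurableSpace E] [BorelSpace E] {η : Measure (Fin d → ℝ)} [IsProbabilityMeasure η]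

lemma charFun_sumLaw (l : List ((Fin d → ℝ) →L[ℝ] E)) (ξ : E) :
    charFun (sumLaw η l) ξ = (l.map fun C => chf η (dualVec C ξ)).prod := by
  rw [charFun_eq_charFunDual_toDualMap, charFunDual_sumLaw]
  congr 1
  refine List.map_congr_left fun C _ => ?_
  rw [chf]
  congr 1
  refine ContinuousLinearMap.ext fun x => ?_
  rw [dotCLM_apply, ← inner_eq_dualVec, real_inner_comm]
  rfl

lemma exists_norm_charFun_sumLaw_le {a C : ℝ} (ha : 0 < a) (hC : 0 < C)
    (hdec : ∀ t ≠ 0, ‖chf η t‖ ≤ C * l1norm t ^ (-a)) (l : List ((Fin d → ℝ) →L[ℝ] E))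
    (hl : ∀ D ∈ l, Function.Surjective D) :
    ∃ B : ℝ, 0 ≤ B ∧ ∀ ξ, ‖charFun (sumLaw η l) ξ‖ ≤ B * (1 + ‖ξ‖) ^ (-(a * l.length)) := by
  induction l with
  | nil => exact ⟨1, zero_le_one, fun ξ => by simp [charFun_sumLaw]⟩
  | cons D l ih =>
    obtain ⟨B, hB, hle⟩ := ih fun D' hD' => hl D' (List.mem_cons_of_mem _ hD')
    obtain ⟨B', hB', hle'⟩ := exists_norm_chf_dualVec_le ha hC hdec (hl D List.mem_cons_self)
    refine ⟨B' * B, by positivity, fun ξ => ?_⟩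
    have hpos : 0 < 1 + ‖ξ‖ := by positivity
    rw [charFun_sumLaw, List.map_cons, List.prod_cons, norm_mul, ← charFun_sumLaw]
    refine (mul_le_mul (hle' ξ) (hle ξ) (norm_nonneg _) (by positivity)).trans_eq ?_
    rw [mul_mul_mul_comm, ← Real.rpow_add hpos, List.length_cons]
    congr 2
    push_cast
    ring

/-- Each surjective summand adds a to the decay exponent; beyond the dimension the characteristic
function is integrable. -/
lemma sumLaw_absolutelyContinuous_of_length {a C : ℝ} (ha : 0 < a) (hC : 0 < C)
    (hdec : ∀ t ≠ 0, ‖chf η t‖ ≤ C * l1norm t ^ (-a)) (l : List ((Fin d → ℝ) →L[ℝ] E))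
    (hl : ∀ D ∈ l, Function.Surjective D) (hlen : (Module.finrank ℝ E : ℝ) < a * l.length) :
    sumLaw η l ≪ Measure.addHaar := by
  obtain ⟨B, hB, hle⟩ := exists_norm_charFun_sumLaw_le ha hC hdec l hl
  have hinteg : Integrable (charFun (sumLaw η l)) :=
    ((integrable_one_add_norm hlen).const_mul B).mono'
      measurable_charFun.aestronglyMeasurable (ae_of_all _ hle)
  exact (absolutelyContinuous_of_integrable_charFun _ hinteg).trans
    (Measure.absolutelyContinuous_isAddHaarMeasure _ _)

end FullRank

/-! ### Absolute continuity by induction on the dimension -/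

section Induction

variable {d : ℕ}

/-- Every spanning family of linear maps into a space of dimension less than `n` yields an
absolutely continuous sum. -/
def AbsContBelow (η : Measure (Fin d → ℝ)) (n : ℕ) : Prop :=
  ∀ (F : Type) [NormedAddCommGroup F] [InnerProductSpace ℝ F] [FiniteDimensional ℝ F]
    [MeasurableSpace F] [BorelSpace F], Module.finrank ℝ F < n →
    ∀ l : List ((Fin d → ℝ) →L[ℝ] F), Spans l → sumLaw η l ≪ Measure.addHaar

variable {E : Type} [NormedAddCommGroup E] [InnerProductSpace ℝ E] [FiniteDimensional ℝ E]
  [MeasurableSpace E] [BorelSpace E]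
  {η : Measure (Fin d → ℝ)} [IsProbabilityMeasure η]

lemma sumLaw_singleton (C : (Fin d → ℝ) →L[ℝ] E) : sumLaw η [C] = η.map C := by
  have : IsProbabilityMeasure (η.map C) := Measure.isProbabilityMeasure_map (by fun_prop)
  rw [sumLaw, sumLaw, Measure.conv_dirac_zero]

/-- Let V be the range of C, a proper nonzero subspace. By induction C Z is absolutely continuous in
V, and so is the projection of the other summands to Vᗮ, where they still span because C contributes
nothing. Fubini combines the two. -/
lemma sumLaw_absolutelyContinuous_of_mem (hbelow : AbsContBelow η (Module.finrank ℝ E))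
    {l : List ((Fin d → ℝ) →L[ℝ] E)} (hl : Spans l) {C : (Fin d → ℝ) →L[ℝ] E} (hC : C ∈ l)
    (h0 : C ≠ 0) (hns : ¬ Function.Surjective C) : sumLaw η l ≪ Measure.addHaar := by
  classical
  set V : Submodule ℝ E := LinearMap.range C.toLinearMap
  have hVtop : V < ⊤ := lt_top_iff_ne_top.2 fun h => hns (LinearMap.range_eq_top.1 h)
  have hVbot : V ≠ ⊥ := fun h => h0 (by
    ext1 x
    have : C x ∈ V := ⟨x, rfl⟩
    rw [h] at this
    exact (Submodule.mem_bot ℝ).1 this)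
  have hVlt : Module.finrank ℝ V < Module.finrank ℝ E := Submodule.finrank_lt hVtop.ne
  have hVpos : 0 < Module.finrank ℝ V := by
    rw [Module.finrank_pos_iff]
    exact Submodule.nontrivial_iff_ne_bot.2 hVbot
  have hadd := V.finrank_add_finrank_orthogonal
  set C' : (Fin d → ℝ) →L[ℝ] V := C.codRestrict V fun x => ⟨x, rfl⟩
  have hC's : Function.Surjective C' := by
    rintro ⟨_, x, rfl⟩
    exact ⟨x, rfl⟩
  have hac1 : η.map C' ≪ Measure.addHaar := by
    rw [← sumLaw_singleton]
    exact hbelow V hVlt [C'] (spans_of_surjective List.mem_cons_self hC's)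
  set q : E →L[ℝ] Vᗮ := Vᗮ.orthogonalProjectionOnto
  have hq : ∀ (y : E) (ξ : Vᗮ), inner ℝ (q y) ξ = inner ℝ y (ξ : E) := fun y ξ =>
    Submodule.inner_orthogonalProjectionOnto_eq_of_mem_right ξ y
  have hac2 : (sumLaw η (l.erase C)).map q ≪ Measure.addHaar := by
    rw [map_sumLaw]
    refine hbelow Vᗮ (by omega) _ fun ξ hξ => ?_
    have : (ξ : E) = 0 := by
      refine hl ξ fun D hD x => ?_
      by_cases hDC : D = C
      · rw [hDC]
        exact Submodule.inner_right_of_mem_orthogonal (K := V) ⟨x, rfl⟩ ξ.2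
      · have := hξ (q.comp D) (List.mem_map.2 ⟨D, (List.mem_erase_of_ne hDC).2 hD, rfl⟩) x
        rw [ContinuousLinearMap.comp_apply, hq] at this
        exact this
    exact Subtype.ext this
  have hp1 : IsProbabilityMeasure (η.map C') := Measure.isProbabilityMeasure_map (by fun_prop)
  rw [sumLaw_perm η (List.perm_cons_erase hC), sumLaw]
  have h5 : η.map C = (η.map C').map V.subtypeL := by
    rw [Measure.map_map (by fun_prop) (by fun_prop)]
    rfl
  rw [h5]
  exact conv_absolutelyContinuous_of_projection V hac1 hac2

end Induction

/-! ### First generation of a single summand -/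

section Children

variable {Ω : Type*} {d : ℕ} {N : Ω → ℕ} {A : ℕ → Ω → Matrix (Fin d) (Fin d) ℝ}
  {E : Type} [NormedAddCommGroup E] [InnerProductSpace ℝ E]

/-- A vector ξ orthogonal to all ranges would make t = `dualVec C ξ` satisfy A_iᵀ t = 0 for every i,
against N(t) ≥ 1. -/
lemma spans_children {ω : Ω} (hb : ∀ i, N ω ≤ i → A i ω = 0)
    (hact : ∀ t : Fin d → ℝ, t ≠ 0 → 1 ≤ activeCount A t ω) {C : (Fin d → ℝ) →L[ℝ] E}
    (hC : Function.Surjective C) : Spans ((childMaps N A ω).map C.comp) := by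
  intro ξ hξ
  by_contra h0
  have hne := dualVec_ne_zero hC h0
  have h1 := hact _ hne
  rw [activeCount, Set.one_le_encard_iff_nonempty] at h1
  obtain ⟨i, hi⟩ := h1
  have hiN : i < N ω := by
    by_contra hcon
    refine hi ?_
    simp [hb i (not_lt.1 hcon)]
  refine hi ?_
  rw [← dualVec_comp_matCLM]
  ext k
  refine hξ _ (List.mem_map.2 ⟨matCLM (A i ω), List.mem_map.2 ⟨i, List.mem_range.2 hiN, rfl⟩, rfl⟩) _

open scoped Classical in
lemma two_le_length_children {ω : Ω} (hb : ∀ i, N ω ≤ i → A i ω = 0) {C : (Fin d → ℝ) →L[ℝ] E}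
    {ξ : E} (hω : ω ∈ twoLarge A (dualVec C ξ)) :
    2 ≤ (((childMaps N A ω).map C.comp).filter (· ≠ 0)).length := by
  obtain ⟨i, j, hij, hi, hj⟩ := hω
  have hpos : ∀ k, 1 ≤ l1norm ((A k ω)ᵀ *ᵥ dualVec C ξ) →
      k ∈ (List.range (N ω)).filter (fun k => C.comp (matCLM (A k ω)) ≠ 0) := by
    intro k hk
    refine List.mem_filter.2 ⟨List.mem_range.2 ?_, decide_eq_true ?_⟩
    · by_contra hcon
      rw [hb k (not_lt.1 hcon), Matrix.transpose_zero, Matrix.zero_mulVec,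
        l1norm_eq_zero.2 rfl] at hk
      linarith
    · intro h0
      rw [← dualVec_comp_matCLM, h0] at hk
      have : dualVec (0 : (Fin d → ℝ) →L[ℝ] E) ξ = 0 := by ext k; simp [dualVec]
      rw [this, l1norm_eq_zero.2 rfl] at hk
      linarith
  have hlen : (((childMaps N A ω).map C.comp).filter (· ≠ 0)).length =
      ((List.range (N ω)).filter (fun k => C.comp (matCLM (A k ω)) ≠ 0)).length := by
    rw [childMaps, List.map_map, List.filter_map, List.length_map]
    rfl
  rw [hlen]
  by_contra! hlt
  have hi' := hpos i hi
  have hj' := hpos j hj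
  generalize (List.range (N ω)).filter (fun k => C.comp (matCLM (A k ω)) ≠ 0) = L at *
  match L, hlt with
  | [], _ => simp at hi'
  | [x], _ =>
    rw [List.mem_singleton] at hi' hj'
    exact hij (hi'.trans hj'.symm)
  | x :: y :: L', h => simp at h

end Children

/-! ### Reducing the number of summands -/

section Expansion

variable {Ω : Type*} [MeasurableSpace Ω] {d : ℕ} {P : Measure Ω}
  {N : Ω → ℕ} {A : ℕ → Ω → Matrix (Fin d) (Fin d) ℝ}
  {η : Measure (Fin d → ℝ)} [IsProbabilityMeasure η]
  {E : Type} [NormedAddCommGroup E] [InnerProductSpace ℝ E] [FiniteDimensional ℝ E]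
  [MeasurableSpace E] [BorelSpace E]

lemma sumLaw_cons_apply_eq_lintegral (hN : Measurable N) (hA : ∀ i, Measurable (A i))
    (hfix : smoothingTransform P N A η = η) (C : (Fin d → ℝ) →L[ℝ] E)
    (l : List ((Fin d → ℝ) →L[ℝ] E)) {S : Set E} (hS : MeasurableSet S) :
    sumLaw η (C :: l) S = ∫⁻ ω, sumLaw η ((childMaps N A ω).map C.comp ++ l) S ∂P := by
  have hind : Measurable (S.indicator (1 : E → ℝ≥0∞)) := measurable_one.indicator hS
  have hg : Measurable fun y : E => ∫⁻ z, S.indicator (1 : E → ℝ≥0∞) (y + z) ∂(sumLaw η l) :=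
    Measurable.lintegral_prod_right' (f := fun p : E × E => S.indicator (1 : E → ℝ≥0∞) (p.1 + p.2))
      (hind.comp measurable_add)
  have h1 : ∀ ν : Measure (Fin d → ℝ), ((ν.map C) ∗ sumLaw η l) S =
      ∫⁻ x, ∫⁻ z, S.indicator (1 : E → ℝ≥0∞) (C x + z) ∂(sumLaw η l) ∂ν := by
    intro ν
    rw [← lintegral_indicator_one hS, Measure.lintegral_conv hind,
      lintegral_map hg C.continuous.measurable]
  rw [sumLaw, h1, lintegral_fixed hN hA hfix
    (g := fun x => ∫⁻ z, S.indicator (1 : E → ℝ≥0∞) (C x + z) ∂(sumLaw η l))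
    (hg.comp C.continuous.measurable)]
  refine lintegral_congr fun ω => ?_
  rw [sumLaw_append, ← map_sumLaw, h1]

variable [IsProbabilityMeasure P]

/-- Let σ be the supremal mass on null sets over families of k surjective maps. Expand the first
summand and discard zero maps. If a remaining map is not surjective, or at least two children
remain, the mass is zero. Otherwise exactly one remains and the mass is at most σ, which happens
with probability at most 1 - p. Hence σ ≤ (1 - p)σ. -/
lemma sumLaw_absolutelyContinuous_descend (hN : Measurable N) (hA : ∀ i, Measurable (A i))
    (hb : BranchingCondition P N A) (hact : ActivityCondition P A)
    (hfix : smoothingTransform P N A η = η) [Nontrivial E]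
    (hbelow : AbsContBelow η (Module.finrank ℝ E)) {k : ℕ} (hk : 0 < k)
    (hup : ∀ l : List ((Fin d → ℝ) →L[ℝ] E), (∀ D ∈ l, Function.Surjective D) → k < l.length →
      sumLaw η l ≪ Measure.addHaar) :
    ∀ l : List ((Fin d → ℝ) →L[ℝ] E), (∀ D ∈ l, Function.Surjective D) → l.length = k →
      sumLaw η l ≪ Measure.addHaar := by
  classical
  set σ : ℝ≥0∞ := ⨆ (l : List ((Fin d → ℝ) →L[ℝ] E)) (_ : (∀ D ∈ l, Function.Surjective D) ∧
    l.length = k) (S : Set E) (_ : MeasurableSet S ∧ (Measure.addHaar : Measure E) S = 0),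
    sumLaw η l S
  have hσle : ∀ l : List ((Fin d → ℝ) →L[ℝ] E), (∀ D ∈ l, Function.Surjective D) → l.length = k →
      ∀ S : Set E, MeasurableSet S → (Measure.addHaar : Measure E) S = 0 → sumLaw η l S ≤ σ :=
    fun l hl hlk S hS hS0 => le_iSup₂_of_le l ⟨hl, hlk⟩ (le_iSup₂_of_le S ⟨hS, hS0⟩ le_rfl)
  have hσ1 : σ ≤ 1 := iSup₂_le fun l _ => iSup₂_le fun S _ => prob_le_one
  obtain ⟨p, R, hp, hR, htwo⟩ := exists_le_measure_twoLarge hact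
  have hkey : σ ≤ (1 - ENNReal.ofReal p) * σ := by
    refine iSup₂_le fun l hl => iSup₂_le fun S hS => ?_
    obtain ⟨hl, hlk⟩ := hl
    obtain ⟨hS, hS0⟩ := hS
    match l, hlk with
    | [], h => simp at h; omega
    | C :: l', hlk =>
    have hC : Function.Surjective C := hl C List.mem_cons_self
    obtain ⟨ξ₀, hξ₀⟩ := exists_ne (0 : E)
    have hdpos := l1norm_pos (dualVec_ne_zero hC hξ₀)
    -- Only whether A_iᵀ t vanishes matters here, so any test direction may be rescaled to norm R;
    -- this makes p independent of the family.
    set ξ : E := (R / l1norm (dualVec C ξ₀)) • ξ₀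
    have hξR : l1norm (dualVec C ξ) = R := by
      rw [dualVec_smul, l1norm_smul, abs_of_pos (by positivity)]
      field_simp
    set T := twoLarge A (dualVec C ξ)
    have hT : MeasurableSet T := measurableSet_twoLarge hA _
    have hPT : P Tᶜ ≤ 1 - ENNReal.ofReal p := by
      rw [prob_compl_eq_one_sub hT]
      exact tsub_le_tsub_left (htwo _ hξR.ge) _
    have hbound : ∀ᵐ ω ∂P, sumLaw η ((childMaps N A ω).map C.comp ++ l') S ≤
        Tᶜ.indicator (fun _ => σ) ω := by
      filter_upwards [hb.eq_zero, hact.one_le] with ω hz ho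
      have hspan := spans_children (E := E) hz ho hC
      set L := (childMaps N A ω).map C.comp
      set m := L.filter (· ≠ 0)
      have hlaw : sumLaw η (L ++ l') = sumLaw η (m ++ l') := by
        rw [sumLaw_append, sumLaw_append, sumLaw_filter_ne_zero]
      have hmspan : Spans (m ++ l') := hspan.mono fun D hD hD0 =>
        List.mem_append_left _ (List.mem_filter.2 ⟨hD, decide_eq_true hD0⟩)
      rw [hlaw]
      by_cases hms : ∀ D ∈ m, Function.Surjective D
      · have hall : ∀ D ∈ m ++ l', Function.Surjective D := fun D hD => by
          rcases List.mem_append.1 hD with h | h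
          · exact hms D h
          · exact hl D (List.mem_cons_of_mem _ h)
        rw [List.length_cons] at hlk
        by_cases h2 : 2 ≤ m.length
        · rw [hup _ hall (by rw [List.length_append]; omega) hS0]
          exact zero_le
        · have hωT : ω ∈ Tᶜ := fun hωT => h2 (two_le_length_children hz hωT)
          rw [Set.indicator_of_mem hωT]
          -- An empty family cannot span a nontrivial space.
          have hm0 : m.length ≠ 0 := by
            intro h0
            rw [List.length_eq_zero_iff] at h0
            have hs0 : Spans m := hspan.mono fun D hD hD0 =>
              List.mem_filter.2 ⟨hD, decide_eq_true hD0⟩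
            rw [h0] at hs0
            exact hξ₀ (hs0 ξ₀ (by simp))
          exact hσle _ hall (by rw [List.length_append]; omega) S hS hS0
      · push Not at hms
        obtain ⟨D, hD, hDs⟩ := hms
        have hD0 : D ≠ 0 := of_decide_eq_true (List.mem_filter.1 hD).2
        rw [sumLaw_absolutelyContinuous_of_mem hbelow hmspan (List.mem_append_left _ hD) hD0 hDs hS0]
        exact zero_le
    rw [sumLaw_cons_apply_eq_lintegral hN hA hfix C l' hS]
    refine (lintegral_mono_ae hbound).trans ?_
    rw [lintegral_indicator_const hT.compl, mul_comm]
    gcongr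
  have hσ0 : σ = 0 := by
    by_contra hne
    have hlt : 1 - ENNReal.ofReal p < 1 :=
      ENNReal.sub_lt_self ENNReal.one_ne_top one_ne_zero (by simpa using hp)
    have h3 : (1 - ENNReal.ofReal p) * σ < 1 * σ :=
      (ENNReal.mul_lt_mul_iff_left hne (hσ1.trans_lt ENNReal.one_lt_top).ne).2 hlt
    rw [one_mul] at h3
    exact absurd hkey (not_le.2 h3)
  intro l hl hlk
  refine Measure.AbsolutelyContinuous.mk fun S hS hS0 => ?_
  exact le_antisymm ((hσle l hl hlk S hS hS0).trans_eq hσ0) zero_le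

/-- Outer induction on the dimension; inside it, a downward induction on the number of surjective
maps, started where Fourier integrability applies. -/
lemma absContBelow (hN : Measurable N) (hA : ∀ i, Measurable (A i))
    (hb : BranchingCondition P N A) (hact : ActivityCondition P A)
    (hfix : smoothingTransform P N A η = η) {a C : ℝ} (ha : 0 < a) (hC : 0 < C)
    (hdec : ∀ t ≠ 0, ‖chf η t‖ ≤ C * l1norm t ^ (-a)) (n : ℕ) : AbsContBelow η n := by
  classical
  induction n with
  | zero => exact fun F _ _ _ _ _ h => absurd h (Nat.not_lt_zero _)
  | succ n ih =>
    intro F _ _ _ _ _ hF l hl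
    have hbelow : AbsContBelow η (Module.finrank ℝ F) := fun G _ _ _ _ _ hG =>
      ih G (hG.trans_le (Nat.lt_succ_iff.1 hF))
    rcases subsingleton_or_nontrivial F with hsub | hnt
    · refine Measure.AbsolutelyContinuous.mk fun S _ hS0 => ?_
      rcases S.eq_empty_or_nonempty with rfl | hS
      · simp
      · rw [Subsingleton.eq_univ_of_nonempty hS] at hS0
        exact absurd hS0 (NeZero.ne _)
    -- From K summands on, the decay exponent exceeds the dimension.
    obtain ⟨K, hK⟩ := exists_nat_gt ((Module.finrank ℝ F : ℝ) / a)
    rw [div_lt_iff₀ ha] at hK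
    have hdesc : ∀ j : ℕ, ∀ l : List ((Fin d → ℝ) →L[ℝ] F), (∀ D ∈ l, Function.Surjective D) →
        0 < l.length → K ≤ l.length + j → sumLaw η l ≪ Measure.addHaar := by
      intro j
      induction j with
      | zero =>
        intro l hl _ hlen
        refine sumLaw_absolutelyContinuous_of_length ha hC hdec l hl (hK.trans_le ?_)
        rw [mul_comm]
        gcongr
        exact hlen
      | succ j ihj =>
        intro l hl hpos hlen
        exact sumLaw_absolutelyContinuous_descend hN hA hb hact hfix hbelow hpos
          (fun l' hl' hlt => ihj l' hl' (by omega) (by omega)) l hl rfl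
    have hm : Spans (l.filter (· ≠ 0)) := hl.mono fun D hD hD0 =>
      List.mem_filter.2 ⟨hD, decide_eq_true hD0⟩
    rw [← sumLaw_filter_ne_zero]
    by_cases hms : ∀ D ∈ l.filter (· ≠ 0), Function.Surjective D
    · refine hdesc K _ hms (List.length_pos_iff.2 fun h0 => ?_) (by omega)
      rw [h0] at hm
      obtain ⟨ξ, hξ⟩ := exists_ne (0 : F)
      exact hξ (hm ξ (by simp))
    · push Not at hms
      obtain ⟨D, hD, hDs⟩ := hms
      exact sumLaw_absolutelyContinuous_of_mem hbelow hm hD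
        (of_decide_eq_true (List.mem_filter.1 hD).2) hDs

/-- The identification with Euclidean space is a one-element spanning family; it supplies the inner
product that `AbsContBelow` asks for. -/
lemma absolutelyContinuous_of_decay (hN : Measurable N) (hA : ∀ i, Measurable (A i))
    (hb : BranchingCondition P N A) (hact : ActivityCondition P A)
    (hfix : smoothingTransform P N A η = η) {a C : ℝ} (ha : 0 < a) (hC : 0 < C)
    (hdec : ∀ t ≠ 0, ‖chf η t‖ ≤ C * l1norm t ^ (-a)) : η ≪ volume := by
  set L : (Fin d → ℝ) ≃L[ℝ] EuclideanSpace ℝ (Fin d) := (EuclideanSpace.equiv (Fin d) ℝ).symm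
  have h1 : η.map L ≪ Measure.addHaar := by
    have := absContBelow hN hA hb hact hfix ha hC hdec _ (EuclideanSpace ℝ (Fin d))
      (Nat.lt_succ_self _) [(L : (Fin d → ℝ) →L[ℝ] EuclideanSpace ℝ (Fin d))]
      (spans_of_surjective List.mem_cons_self L.surjective)
    rwa [sumLaw_singleton] at this
  have h2 := h1.map L.symm.continuous.measurable
  rw [Measure.map_map L.symm.continuous.measurable L.continuous.measurable] at h2
  have h3 : (L.symm ∘ L : (Fin d → ℝ) → Fin d → ℝ) = id := by ext1 x; simp
  rw [h3, Measure.map_id] at h2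
  have : ((Measure.addHaar : Measure (EuclideanSpace ℝ (Fin d))).map L.symm).IsAddHaarMeasure :=
    L.symm.isAddHaarMeasure_map _
  exact h2.trans (Measure.absolutelyContinuous_isAddHaarMeasure _ _)

end Expansion

/-! ### Supports -/

section Support

variable {d : ℕ} {η : Measure (Fin d → ℝ)}

lemma dotProduct_eq_of_mem_support {t x : Fin d → ℝ} {c : ℝ} (h : ∀ᵐ x ∂η, t ⬝ᵥ x = c)
    (hx : x ∈ η.support) : t ⬝ᵥ x = c := by
  have hclosed : IsClosed {x : Fin d → ℝ | t ⬝ᵥ x = c} :=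
    isClosed_eq (continuous_const.dotProduct continuous_id) continuous_const
  exact Measure.support_subset_of_isClosed hclosed h hx

/-- The support contains 0 and every v_i, so a constant ⟨t, Z⟩ would make t orthogonal to a basis.
-/
lemma not_ae_const_of_rays {v : Fin d → (Fin d → ℝ)} (hv : LinearIndependent ℝ v)
    (hsupp : ∀ i, ∀ s : ℝ, 0 ≤ s → s • v i ∈ η.support) (t : Fin d → ℝ) (ht : t ≠ 0) (c : ℝ) :
    ¬ ∀ᵐ x ∂η, t ⬝ᵥ x = c := by
  intro h
  have h0 : ∀ i, t ⬝ᵥ v i = 0 := by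
    intro i
    have h1 := dotProduct_eq_of_mem_support h (hsupp i 0 le_rfl)
    have h2 := dotProduct_eq_of_mem_support h (hsupp i 1 zero_le_one)
    rw [zero_smul, dotProduct_zero] at h1
    rw [one_smul] at h2
    rw [h2, h1]
  have hspan : Submodule.span ℝ (Set.range v) = ⊤ := hv.span_eq_top_of_card_eq_finrank' (by simp)
  have hz : (dotCLM t : (Fin d → ℝ) →ₗ[ℝ] ℝ) = 0 :=
    LinearMap.ext_on_range hspan fun i => h0 i
  have h3 : t ⬝ᵥ t = 0 := LinearMap.congr_fun hz t
  exact ht (dotProduct_self_eq_zero.1 h3)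

end Support

end Smoothing

end

theorem mainTheorem3 {d : ℕ}
    {Ω : Type*} [MeasurableSpace Ω] (P : Measure Ω) [IsProbabilityMeasure P]
    (N : Ω → ℕ) (hN : Measurable N)
    (A : ℕ → Ω → Matrix (Fin d) (Fin d) ℝ) (hA : ∀ i, Measurable (A i))
    (h_branch : Smoothing.BranchingCondition P N A)
    (h_alpha : Smoothing.AlphaCondition P N A)
    (h_active : Smoothing.ActivityCondition P A)
    {Ω' : Type*} [MeasurableSpace Ω'] (Q : Measure Ω') [IsProbabilityMeasure Q]
    (Z : Ω' → Fin d → ℝ) (hZ : Measurable Z)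
    (hZ_nonneg : ∀ᵐ ω ∂Q, 0 ≤ Z ω)
    (hZ_fixed : Smoothing.smoothingTransform P N A (Q.map Z) = Q.map Z)
    (hZ_zero : Q {ω | Z ω = 0} = 0) :
    ((∀ t : Fin d → ℝ, t ≠ 0 → ∀ c : ℝ, ¬ ∀ᵐ ω ∂Q, t ⬝ᵥ Z ω = c) →
      ∃ a C : ℝ, 0 < a ∧ 0 < C ∧ ∀ t : Fin d → ℝ, t ≠ 0 →
        ‖∫ ω, Complex.exp (Complex.I * ((t ⬝ᵥ Z ω : ℝ) : ℂ)) ∂Q‖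
          ≤ C * Smoothing.l1norm t ^ (-a)) ∧
    ((∃ v : Fin d → (Fin d → ℝ), LinearIndependent ℝ v ∧
        (∀ i, 0 ≤ v i ∧ v i ≠ 0) ∧
        ∀ i, ∀ s : ℝ, 0 ≤ s → s • v i ∈ (Q.map Z).support) →
      Q.map Z ≪ volume) := by
  have hprob : IsProbabilityMeasure (Q.map Z) := Measure.isProbabilityMeasure_map hZ.aemeasurable
  refine ⟨fun hnd => ?_, fun ⟨v, hv, _, hsupp⟩ => ?_⟩
  · obtain ⟨a, C, ha, hC, hdec⟩ := Smoothing.exists_decay hN hA h_branch h_alpha h_active hZ_fixed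
      fun t ht c h => hnd t ht c (ae_of_ae_map hZ.aemeasurable h)
    refine ⟨a, C, ha, hC, fun t ht => ?_⟩
    have h1 : ∫ ω, Complex.exp (Complex.I * ((t ⬝ᵥ Z ω : ℝ) : ℂ)) ∂Q =
        Smoothing.chf (Q.map Z) t := by
      rw [Smoothing.chf_apply, integral_map hZ.aemeasurable
        (Continuous.aestronglyMeasurable (by fun_prop))]
      simp only [mul_comm]
    rw [h1]
    exact hdec t ht
  · obtain ⟨a, C, ha, hC, hdec⟩ := Smoothing.exists_decay hN hA h_branch h_alpha h_active hZ_fixed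
      (Smoothing.not_ae_const_of_rays hv hsupp)
    exact Smoothing.absolutelyContinuous_of_decay hN hA h_branch h_active hZ_fixed ha hC hdec
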